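/- Let $A$ be an alphabet with $N\ge 2$ letters and $F$ the free group with basis $A$, seen as the set of reduced words in $A\cup A^{-1}$. Let $\partial F$ be the set of infinite reduced words $V=V_0V_1\dots$ (with the topology of letterwise convergence), $\partial^2F=(\partial F\times\partial F)\setminus\{\text{diagonal}\}$, and $S(X,Y)=(Y_0^{-1}X,\,Y_0^{-1}Y)$ the shift on $\partial^2F$, with inverse $S^{-1}(X,Y)=(X_0^{-1}X,\,X_0^{-1}Y)$ on the pairs with $X_0\ne Y_0$. **CIETs.** A completed interval exchange transformation (CIET) $\delta=(\pi,\lambda)$ is given by a pair $\pi=(\pi_0,\pi_1)$ of bijections $A\to\{0,\dots,N-1\}$ and a vector $\lambda=(\lambda_a)_{a\in A}$ of positive reals. Put $|\lambda|=\sum_a\lambda_a$ and $\Lambda_i(a)=\sum_{\pi_i(b)<\pi_i(a)}\lambda_b$ for $i=0,1$. For $a\in A$ let $\delta_a:[\Lambda_0(a),\Lambda_0(a)+\lambda_a]\to[\Lambda_1(a),\Lambda_1(a)+\lambda_a]$ be the translation, and $\delta_{a^{-1}}=\delta_a^{-1}$. The $\delta$-subshift $\Sigma_\delta$ is the set of all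 $(U,V)\in\partial^2F$ for which there is $x\in[0,|\lambda|]$ such that, for all $n\ge 0$, $U_n^{-1}\in A$, $V_n\in A$, and $x$ lies in the domains of $\delta_{U_n}\circ\dots\circ\delta_{U_0}$ and of $\delta_{V_n}\circ\dots\circ\delta_{V_0}$. **Rauzy induction.** Let $\alpha_i=\pi_i^{-1}(N-1)$. If $\lambda_{\alpha_0}>\lambda_{\alpha_1}$ (type 0), then $R(\delta)=(\pi',\lambda')$ with $\pi_0'=\pi_0$; $\pi_1'(a)=\pi_1(a)$ if $\pi_1(a)\le\pi_1(\alpha_0)$, $\pi_1'(\alpha_1)=\pi_1(\alpha_0)+1$, $\pi_1'(a)=\pi_1(a)+1$ if $\pi_1(\alpha_0)<\pi_1(a)<N-1$; $\lambda'_{\alpha_0}=\lambda_{\alpha_0}-\lambda_{\alpha_1}$ and $\lambda'_a=\lambda_a$ for $a\neq\alpha_0$. The associated Dehn twist is the automorphism $\sigma$ of $F$ with $\sigma(\alpha_1)=\alpha_1\alpha_0$ and $\sigma(a)=a$ for $a\ne\alpha_1$. If $\lambda_{\alpha_0}<\lambda_{\alpha_1}$ (type 1), then $R(\delta)$ is defined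 by exchanging the indices $0$ and $1$ in the formulas for $\pi'$ and $\lambda'$, and the Dehn twist is given by $\sigma(\alpha_0)=\alpha_1\alpha_0$ and $\sigma(a)=a$ for $a\ne\alpha_0$. If $\lambda_{\alpha_0}=\lambda_{\alpha_1}$, $R(\delta)$ is not defined. The CIET $\delta=(\pi,\lambda)$ is self-induced if there is $n\ge1$ such that $R^n(\delta)$ is defined and equals $(\pi,\eta\lambda)$ for some real $\eta>0$. Let $n$ be the smallest such integer and $\sigma_i$ the Dehn twist associated with the Rauzy induction of $R^i(\delta)$. The $\delta$-automorphism is $\varphi=\sigma_0\circ\dots\circ\sigma_{n-1}$. **Attracting subshift.** An automorphism $\varphi$ of $F$ is positive if each $\varphi(a)$, $a\in A$, is a word in $A$; it is primitive if for some $k\ge1$ every letter of $A$ occurs in $\varphi^k(a)$ for every $a\in A$. Given a positive primitive $\varphi$, choose $a\in A$, $k\ge1$ and non-empty words $p,s$ in $A$ with $\varphi^k(a)=pas$, and let $$X=\lim_{m\to\infty}p^{-1}\varphi^k(p^{-1})\cdots\varphi^{mk}(p^{-1}),\qquad Y=\lim_{m\to\infty}as\varphi^k(s)\cdots\varphi^{mk}(s).$$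 The attracting subshift is $\Sigma_\varphi=\overline{\{S^m(X,Y):m\in\mathbb Z\}}$ (closure in $\partial^2F$). **Theorem.** Let $\delta=(\pi,\lambda)$ be a self-induced CIET and let $\varphi$ be its $\delta$-automorphism. Then $\varphi$ is positive and primitive; for every $a\in A$ there are $k,p,s$ as above; and for every choice of $a,k,p,s$ as above the limits $X,Y$ exist, $(X,Y)\in\partial^2F$, and $$\Sigma_\delta=\Sigma_\varphi=\overline{\{S^m(X,Y):m\in\mathbb Z\}}.$$ -/

import Mathlib

/-! ### The free group, its boundary and the shift

The letters of `A ∪ A⁻¹` are the pairs `(a, true)` (for `a`) and `(a, false)` (for `a⁻¹`), as in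
Mathlib's `FreeGroup`. -/

namespace FreeBoundary

/-- The inverse of a letter. -/
def invLetter {A : Type*} (l : A × Bool) : A × Bool := (l.1, !l.2)

end FreeBoundary

/-- The boundary `∂F` of the free group on `A`: infinite reduced words. -/
def FreeBoundary (A : Type*) : Type _ :=
  {V : ℕ → A × Bool // ∀ i, V (i + 1) ≠ FreeBoundary.invLetter (V i)}

namespace FreeBoundary

variable {A : Type*}

/-- The topology of `∂F`: induced by the product topology, the set of letters being discrete. -/
instance : TopologicalSpace (FreeBoundary A) :=
  TopologicalSpace.induced Subtype.val
    (@Pi.topologicalSpace ℕ (fun _ => A × Bool) (fun _ => ⊥))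

/-- The `i`-th letter of an infinite word. -/
def letter (V : FreeBoundary A) (i : ℕ) : A × Bool := V.1 i

theorem invLetter_invLetter (l : A × Bool) : invLetter (invLetter l) = l := by
  simp [invLetter]

/-- Removing the first letter. -/
def tail (V : FreeBoundary A) : FreeBoundary A := ⟨fun i => V.1 (i + 1), fun i => V.2 (i + 1)⟩

/-- Adding a first letter that does not cancel. -/
def cons (l : A × Bool) (V : FreeBoundary A) (h : V.letter 0 ≠ invLetter l) : FreeBoundary A :=
  ⟨fun i => Nat.casesOn i l (fun j => V.1 j), fun i => by
    cases i with
    | zero => exact h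
    | succ j => exact V.2 j⟩

open Classical in
/-- The product `l · V` of a letter and an infinite reduced word, reduced. -/
noncomputable def letterMul (l : A × Bool) (V : FreeBoundary A) : FreeBoundary A :=
  if h : V.letter 0 = invLetter l then V.tail else V.cons l h

theorem letterMul_invLetter_letterMul (l : A × Bool) (V : FreeBoundary A) :
    letterMul (invLetter l) (letterMul l V) = V := by
  by_cases h : V.letter 0 = invLetter l
  · have h1 : letterMul l V = V.tail := by simp [letterMul, h]
    have h2 : V.tail.letter 0 ≠ invLetter (invLetter l) := by
      have := V.2 0
      rw [show V.1 0 = invLetter l from h] at this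
      exact this
    rw [h1, letterMul, dif_neg h2]
    apply Subtype.ext
    funext i
    cases i with
    | zero => exact h.symm
    | succ j => rfl
  · have h1 : letterMul l V = V.cons l h := by simp [letterMul, h]
    have h2 : (V.cons l h).letter 0 = invLetter (invLetter l) := by
      rw [invLetter_invLetter]; rfl
    rw [h1, letterMul, dif_pos h2]
    rfl

theorem letterMul_injective (l : A × Bool) :
    Function.Injective (letterMul l : FreeBoundary A → FreeBoundary A) :=
  Function.LeftInverse.injective (letterMul_invLetter_letterMul l)

end FreeBoundary

/-- The double boundary `∂²F = (∂F × ∂F) \ Δ`, with the topology of a subspace of the product. -/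
abbrev DoubleBoundary (A : Type*) : Type _ :=
  {P : FreeBoundary A × FreeBoundary A // P.1 ≠ P.2}

namespace DoubleBoundary

open FreeBoundary

variable {A : Type*}

/-- Simultaneous left multiplication of both coordinates by a letter. -/
noncomputable def letterMul (l : A × Bool) (P : DoubleBoundary A) : DoubleBoundary A :=
  ⟨(FreeBoundary.letterMul l P.1.1, FreeBoundary.letterMul l P.1.2),
    fun h => P.2 (letterMul_injective l h)⟩

/-- The shift `S (X, Y) = (Y₀⁻¹ X, Y₀⁻¹ Y)`. -/
noncomputable def shift (P : DoubleBoundary A) : DoubleBoundary A :=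
  letterMul (invLetter (P.1.2.letter 0)) P

/-- The backward shift `(X, Y) ↦ (X₀⁻¹ X, X₀⁻¹ Y)`. On the pairs with `X₀ ≠ Y₀`, those for which
`X⁻¹ Y` is a reduced bi-infinite word, it is the inverse of `S`. -/
noncomputable def unshift (P : DoubleBoundary A) : DoubleBoundary A :=
  letterMul (invLetter (P.1.1.letter 0)) P

theorem FreeBoundary_letterMul_of_ne (l : A × Bool) (V : FreeBoundary A)
    (h : V.letter 0 ≠ invLetter l) : (FreeBoundary.letterMul l V).letter 0 = l := by
  rw [FreeBoundary.letterMul, dif_neg h]; rfl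

theorem shift_unshift (P : DoubleBoundary A) (h : P.1.1.letter 0 ≠ P.1.2.letter 0) :
    shift (unshift P) = P := by
  have h0 : (unshift P).1.2.letter 0 = invLetter (P.1.1.letter 0) :=
    FreeBoundary_letterMul_of_ne _ _ (by rw [invLetter_invLetter]; exact h.symm)
  unfold shift
  rw [h0]
  apply Subtype.ext
  exact Prod.ext (letterMul_invLetter_letterMul _ _) (letterMul_invLetter_letterMul _ _)

theorem unshift_shift (P : DoubleBoundary A) (h : P.1.1.letter 0 ≠ P.1.2.letter 0) :
    unshift (shift P) = P := by
  have h0 : (shift P).1.1.letter 0 = invLetter (P.1.2.letter 0) :=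
    FreeBoundary_letterMul_of_ne _ _ (by rw [invLetter_invLetter]; exact h)
  unfold unshift
  rw [h0]
  apply Subtype.ext
  exact Prod.ext (letterMul_invLetter_letterMul _ _) (letterMul_invLetter_letterMul _ _)

/-- The two-sided orbit `{Sⁿ Z ; n ∈ ℤ}`. -/
def orbit (Z : DoubleBoundary A) : Set (DoubleBoundary A) :=
  {W | ∃ n : ℕ, W = shift^[n] Z ∨ W = unshift^[n] Z}

end DoubleBoundary

/-! ### Positive primitive automorphisms and the attracting subshift -/

namespace FreeGroupAut

variable {A : Type*} [DecidableEq A]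

/-- All the letters of the reduced word `w` are in `A`. -/
def IsPositiveWord (w : FreeGroup A) : Prop := ∀ l ∈ w.toWord, l.2 = true

/-- `φ(a)` is a word with letters in `A`, for every `a ∈ A`. -/
def IsPositive (φ : MulAut (FreeGroup A)) : Prop :=
  ∀ a : A, IsPositiveWord (φ (FreeGroup.of a))

/-- For some `k ≥ 1`, every element of `A` is a letter of `φᵏ(a)`, for every `a ∈ A`. -/
def IsPrimitive (φ : MulAut (FreeGroup A)) : Prop :=
  ∃ k : ℕ, 0 < k ∧ ∀ a b : A, (b, true) ∈ ((φ ^ k) (FreeGroup.of a)).toWord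

/-- `φᵏ(a) = p a s` with `k ≥ 1`, where `p` and `s` are non-empty words with letters in `A`. -/
structure IsSeed (φ : MulAut (FreeGroup A)) (a : A) (k : ℕ) (p s : FreeGroup A) : Prop where
  pos : 0 < k
  prefix_ne : p ≠ 1
  prefix_pos : IsPositiveWord p
  suffix_ne : s ≠ 1
  suffix_pos : IsPositiveWord s
  eq : (φ ^ k) (FreeGroup.of a) = p * FreeGroup.of a * s

/-- Convergence of a sequence of reduced finite words to an infinite reduced word: every letter of
the limit is eventually the letter of the words at the same place. -/
def WordsTendTo (w : ℕ → FreeGroup A) (V : FreeBoundary A) : Prop :=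
  ∀ i : ℕ, ∀ᶠ n in Filter.atTop, (w n).toWord[i]? = some (V.letter i)

/-- The ordered product `w φᵏ(w) φ²ᵏ(w) ⋯ φⁿᵏ(w)`. -/
def iteratedWord (φ : MulAut (FreeGroup A)) (k : ℕ) (w : FreeGroup A) (n : ℕ) : FreeGroup A :=
  ((List.range (n + 1)).map fun j => (φ ^ (j * k)) w).prod

/-- `Z = (X, Y)` with `X = lim p⁻¹ φᵏ(p⁻¹) ⋯ φⁿᵏ(p⁻¹)` and `Y = lim a s φᵏ(s) ⋯ φⁿᵏ(s)`. -/
def IsLimitPoint (φ : MulAut (FreeGroup A)) (a : A) (k : ℕ) (p s : FreeGroup A)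
    (Z : DoubleBoundary A) : Prop :=
  WordsTendTo (fun n => iteratedWord φ k p⁻¹ n) Z.1.1 ∧
    WordsTendTo (fun n => FreeGroup.of a * iteratedWord φ k s n) Z.1.2

/-- The automorphism `c ↦ c · u` for the letter `c`, fixing all other letters, where the letter
`u` is different from `c`. -/
def rightTwist (c u : A) (h : u ≠ c) : MulAut (FreeGroup A) :=
  MonoidHom.toMulEquiv
    (FreeGroup.lift fun a => if a = c then FreeGroup.of c * FreeGroup.of u else FreeGroup.of a)
    (FreeGroup.lift fun a => if a = c then FreeGroup.of c * (FreeGroup.of u)⁻¹ else FreeGroup.of a)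
    (by ext a; by_cases ha : a = c <;> simp [ha, h])
    (by ext a; by_cases ha : a = c <;> simp [ha, h])

/-- The automorphism `c ↦ u · c` for the letter `c`, fixing all other letters, where the letter
`u` is different from `c`. -/
def leftTwist (c u : A) (h : u ≠ c) : MulAut (FreeGroup A) :=
  MonoidHom.toMulEquiv
    (FreeGroup.lift fun a => if a = c then FreeGroup.of u * FreeGroup.of c else FreeGroup.of a)
    (FreeGroup.lift fun a => if a = c then (FreeGroup.of u)⁻¹ * FreeGroup.of c else FreeGroup.of a)
    (by ext a; by_cases ha : a = c <;> simp [ha, h])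
    (by ext a; by_cases ha : a = c <;> simp [ha, h])

end FreeGroupAut

/-! ### Completed interval exchange transformations -/

/-- A completed interval exchange transformation on an alphabet `A` with `N ≥ 2` letters, given by
a pair of bijections `π₀, π₁ : A → {0, …, N-1}` and a vector of positive lengths. -/
structure CIET (A : Type*) (N : ℕ) where
  two_le : 2 ≤ N
  perm0 : A ≃ Fin N
  perm1 : A ≃ Fin N
  len : A → ℝ
  len_pos : ∀ a, 0 < len a

/-- The permutation of `{0, …, N-1}` that fixes every `j ≤ p`, sends `N-1` to `p+1` (if `p < N-1`)
and sends `j` to `j+1` if `p < j < N-1`. -/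
noncomputable def moveLastAfter {N : ℕ} (p : Fin N) : Equiv.Perm (Fin N) :=
  Equiv.ofBijective
    (fun j => if h : j.1 ≤ p.1 then j
      else if h' : j.1 + 1 = N then ⟨p.1 + 1, by omega⟩
      else ⟨j.1 + 1, by omega⟩)
    (Finite.injective_iff_bijective.1 (by
      intro i j hij
      ext
      dsimp only at hij
      split_ifs at hij <;> simp only [Fin.ext_iff] at hij <;> omega))

namespace CIET

variable {A : Type*} {N : ℕ}

section Coding

variable [Fintype A]

/-- `Λ₀(a)`, the sum of the `λ_b` with `π₀(b) < π₀(a)`. -/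
noncomputable def left0 (δ : CIET A N) (a : A) : ℝ :=
  ∑ b with δ.perm0 b < δ.perm0 a, δ.len b

/-- `Λ₁(a)`, the sum of the `λ_b` with `π₁(b) < π₁(a)`. -/
noncomputable def left1 (δ : CIET A N) (a : A) : ℝ :=
  ∑ b with δ.perm1 b < δ.perm1 a, δ.len b

/-- `|λ|`. -/
noncomputable def total (δ : CIET A N) : ℝ := ∑ a, δ.len a

/-- The partial isometries: for the letter `a` the translation
`δ_a : [Λ₀(a), Λ₀(a) + λ_a] → [Λ₁(a), Λ₁(a) + λ_a]`, and for `a⁻¹` its inverse. -/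
noncomputable def isom (δ : CIET A N) : A × Bool → ℝ →. ℝ
  | (a, true) => PFun.res (fun x => x - δ.left0 a + δ.left1 a)
      (Set.Icc (δ.left0 a) (δ.left0 a + δ.len a))
  | (a, false) => PFun.res (fun x => x - δ.left1 a + δ.left0 a)
      (Set.Icc (δ.left1 a) (δ.left1 a + δ.len a))

/-- The partial map `δ_{V_n} ∘ ⋯ ∘ δ_{V_0}`. -/
noncomputable def isomComp (δ : CIET A N) (V : FreeBoundary A) : ℕ → ℝ →. ℝ
  | 0 => δ.isom (V.letter 0)
  | n + 1 => (δ.isom (V.letter (n + 1))).comp (isomComp δ V n)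

/-- `Σ_δ(x)`. -/
def subshiftAt (δ : CIET A N) (x : ℝ) : Set (DoubleBoundary A) :=
  {P | ∀ n : ℕ,
    ((P.1.1.letter n).2 = false ∧ x ∈ (δ.isomComp P.1.1 n).Dom) ∧
    ((P.1.2.letter n).2 = true ∧ x ∈ (δ.isomComp P.1.2 n).Dom)}

/-- The `δ`-subshift `Σ_δ`. -/
def subshift (δ : CIET A N) : Set (DoubleBoundary A) :=
  ⋃ x ∈ Set.Icc (0 : ℝ) δ.total, δ.subshiftAt x

end Coding

/-- The letter `α₀` with `π₀(α₀) = N-1`. -/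
def last0 (δ : CIET A N) : A := δ.perm0.symm ⟨N - 1, by have := δ.two_le; omega⟩

/-- The letter `α₁` with `π₁(α₁) = N-1`. -/
def last1 (δ : CIET A N) : A := δ.perm1.symm ⟨N - 1, by have := δ.two_le; omega⟩

theorem last1_ne_last0_of_lt (δ : CIET A N) (h : δ.len δ.last1 < δ.len δ.last0) :
    δ.last0 ≠ δ.last1 := fun e => by rw [e] at h; exact lt_irrefl _ h

theorem last0_ne_last1_of_lt (δ : CIET A N) (h : δ.len δ.last0 < δ.len δ.last1) :
    δ.last1 ≠ δ.last0 := fun e => by rw [e] at h; exact lt_irrefl _ h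

variable [DecidableEq A]

/-- Rauzy induction of type `0`. -/
noncomputable def rauzy0 (δ : CIET A N) (h : δ.len δ.last1 < δ.len δ.last0) : CIET A N where
  two_le := δ.two_le
  perm0 := δ.perm0
  perm1 := δ.perm1.trans (moveLastAfter (δ.perm1 δ.last0))
  len := Function.update δ.len δ.last0 (δ.len δ.last0 - δ.len δ.last1)
  len_pos a := by
    by_cases ha : a = δ.last0
    · subst ha; simpa using h
    · simpa [ha] using δ.len_pos a

/-- Rauzy induction of type `1`. -/
noncomputable def rauzy1 (δ : CIET A N) (h : δ.len δ.last0 < δ.len δ.last1) : CIET A N where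
  two_le := δ.two_le
  perm0 := δ.perm0.trans (moveLastAfter (δ.perm0 δ.last1))
  perm1 := δ.perm1
  len := Function.update δ.len δ.last1 (δ.len δ.last1 - δ.len δ.last0)
  len_pos a := by
    by_cases ha : a = δ.last1
    · subst ha; simpa using h
    · simpa [ha] using δ.len_pos a

/-- `λ_{α₀} ≠ λ_{α₁}`: the condition for the Rauzy induction of `δ` to be defined. -/
def Inducible (δ : CIET A N) : Prop := δ.len δ.last0 ≠ δ.len δ.last1

/-- The completed Rauzy induction `R(δ)`; only meaningful if `δ` is inducible. -/
noncomputable def rauzy (δ : CIET A N) : CIET A N :=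
  if h : δ.len δ.last1 < δ.len δ.last0 then δ.rauzy0 h
  else if h' : δ.len δ.last0 < δ.len δ.last1 then δ.rauzy1 h'
  else δ

/-- The Dehn twist of the Rauzy induction of `δ`: `α₁ ↦ α₁ α₀` for the type `0`, `α₀ ↦ α₁ α₀` for
the type `1`, the other letters being fixed; only meaningful if `δ` is inducible. -/
noncomputable def twist (δ : CIET A N) : MulAut (FreeGroup A) :=
  if h : δ.len δ.last1 < δ.len δ.last0 then
    FreeGroupAut.rightTwist δ.last1 δ.last0 (δ.last1_ne_last0_of_lt h)
  else if h' : δ.len δ.last0 < δ.len δ.last1 then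
    FreeGroupAut.leftTwist δ.last0 δ.last1 (δ.last0_ne_last1_of_lt h')
  else 1

/-- `n ≥ 1`, the iterate `Rⁿ(δ)` is defined, and `Rⁿ(π, λ) = (π, η λ)` for some `η > 0`. -/
def IsReturnTime (δ : CIET A N) (n : ℕ) : Prop :=
  0 < n ∧ (∀ i < n, (rauzy^[i] δ).Inducible) ∧
    (rauzy^[n] δ).perm0 = δ.perm0 ∧ (rauzy^[n] δ).perm1 = δ.perm1 ∧
    ∃ η : ℝ, 0 < η ∧ ∀ a, (rauzy^[n] δ).len a = η * δ.len a

/-- `δ` is self-induced. -/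
def IsSelfInduced (δ : CIET A N) : Prop := ∃ n, δ.IsReturnTime n

/-- The length of the minimal Rauzy cycle of a self-induced `δ`. -/
noncomputable def period (δ : CIET A N) : ℕ := sInf {n | δ.IsReturnTime n}

/-- The `δ`-automorphism `φ = σ₀ ∘ ⋯ ∘ σ_{n-1}` of a self-induced `δ`, where `n` is the length of
the minimal Rauzy cycle and `σ_i` is the Dehn twist of the Rauzy induction of `Rⁱ(δ)`. -/
noncomputable def automorphism (δ : CIET A N) : MulAut (FreeGroup A) :=
  ((List.range δ.period).map fun i => (rauzy^[i] δ).twist).prod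

end CIET

/-! ### Words and flat maps -/

namespace List

variable {α β : Type*}

/-! A word is in the language of a CIET when the translations along its letters compose at some
point (`Path`, `language`). As the intervals are closed, compactness shows that `Σ_δ` consists of
the bi-infinite words whose central factors are all in the language of `δ` (`subshift_eq_image`).
Likewise `Σ_φ` consists of the bi-infinite words whose central factors all occur in the limit word
of the seed, that is, in some `φ^(qk)(a)` (`closure_orbit_ofBiinfinite`, `IsSeed.exists_limit`). So
two sets of finite words have to be compared (`IsReturn.mem_language_iff`).

The Dehn twist turns a path of `R(δ)` into a path of `δ` with the same endpoints
(`Inducible.path_image`), and every non-empty path of `δ` extends to such an image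
(`Inducible.exists_extension`). After `q` cycles of length `n`, `R^(nq)(δ)` is `δ` rescaled by `η^q`
and has the same language. Hence every `φ^q(a)` is in the language, and every word `w` of the
language is a factor of some `φ^q(u)` with `u` in the language. For `q` large, `w` meets at most two
blocks, so that it suffices to find every two-letter word `bc` of the language inside a single
`φ^q(d)` (`IsReturn.pair_isInfix`). Take a path along `bc` whose middle point `y` is positive. A
block boundary at `y` would put `y` in the domain of `R^(nq)(δ)`, of length `η^q |λ|`; since `η <
1`, this is impossible for `q` large.

Primitivity: a letter that stops winning keeps its length, whereas a cycle multiplies it by `η < 1`.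
So every letter wins infinitely often, which forces every letter into every image
(`InfinitelyInducible.eventually_mem_image`). -/

theorem flatMap_ne_nil_of_ne_nil {f : α → List β} (hf : ∀ a, f a ≠ []) {w : List α} (hw : w ≠ []) :
    w.flatMap f ≠ [] := by
  cases w with
  | nil => exact absurd rfl hw
  | cons a t => simp [hf a]

theorem isInfix_flatMap_of_mem {f : α → List β} {w : List α} {a : α} (h : a ∈ w) :
    f a <:+: w.flatMap f := by
  obtain ⟨s, t, rfl⟩ := append_of_mem h
  exact ⟨s.flatMap f, t.flatMap f, by simp⟩

theorem length_le_length_flatMap {f : α → List β} (hf : ∀ a, f a ≠ []) (w : List α) :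
    w.length ≤ (w.flatMap f).length := by
  induction w with
  | nil => simp
  | cons a t ih =>
    have := length_pos_iff.2 (hf a)
    simp only [flatMap_cons, length_append, length_cons]
    omega

/-- A word that is no longer than the blocks of a concatenation meets at most two of them. -/
theorem isInfix_flatMap_cases {f : α → List β} {u : List β} (hu : u ≠ [])
    (hf : ∀ a, u.length ≤ (f a).length) {w : List α} (h : u <:+: w.flatMap f) :
    (∃ a, u <:+: f a) ∨ ∃ a b, [a, b] <:+: w ∧ u <:+: f a ++ f b := by
  induction w with
  | nil => simp at h; exact absurd h hu
  | cons a t ih =>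
    rw [flatMap_cons, infix_append_iff] at h
    rcases h with h | h | ⟨v, v', rfl, hv, hv'⟩
    · exact Or.inl ⟨a, h⟩
    · rcases ih h with h | ⟨b, c, hbc, h⟩
      · exact Or.inl h
      · exact Or.inr ⟨b, c, hbc.trans (suffix_cons a t).isInfix, h⟩
    · cases t with
      | nil =>
        simp at hv'
        subst hv'
        exact Or.inl ⟨a, by simpa using hv.isInfix⟩
      | cons b t =>
        refine Or.inr ⟨a, b, (prefix_append [a, b] t).isInfix, ?_⟩
        -- `v'` is part of `u`, hence no longer than the block `f b`: it cannot reach a third block.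
        have h1 : v' <+: f b := by
          refine prefix_of_prefix_length_le hv' (prefix_append _ _) ?_
          have := hf b
          simp only [length_append] at this
          omega
        obtain ⟨r, hr⟩ := hv
        obtain ⟨r', hr'⟩ := h1
        exact ⟨r, r', by rw [← hr, ← hr']; simp⟩

/-- Two consecutive letters of a concatenation are in the same block, or are separated by a
block boundary. -/
theorem pair_flatMap_cases {f : α → List β} {b c : β} {w : List α} :
    ∀ {r s : List β}, w.flatMap f = r ++ b :: c :: s →
      (∃ a ∈ w, [b, c] <:+: f a) ∨ ∃ v v', w = v ++ v' ∧ v.flatMap f = r ++ [b] := by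
  induction w with
  | nil => intro r s h; simp at h
  | cons a t ih =>
    intro r s h
    have h' : f a ++ t.flatMap f = (r ++ [b]) ++ (c :: s) := by simpa using h
    rw [append_eq_append_iff] at h'
    rcases h' with ⟨z, hz, hz'⟩ | ⟨z, hz, hz'⟩
    · rcases eq_nil_or_concat' z with rfl | ⟨z, x, rfl⟩
      · exact Or.inr ⟨[a], t, rfl, by simpa using hz.symm⟩
      · rw [← append_assoc] at hz
        obtain ⟨rfl, hx⟩ := append_inj' hz rfl
        obtain rfl : b = x := by simpa using hx
        rcases ih (r := z) (s := s) (by simpa using hz') with ⟨d, hd, hb⟩ | ⟨v, v', rfl, hv⟩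
        · exact Or.inl ⟨d, mem_cons_of_mem _ hd, hb⟩
        · exact Or.inr ⟨a :: v, v', rfl, by simp [hv]⟩
    · cases z with
      | nil => exact Or.inr ⟨[a], t, rfl, by simpa using hz⟩
      | cons x z =>
        obtain ⟨rfl, -⟩ : c = x ∧ _ := by simpa using hz'
        exact Or.inl ⟨a, mem_cons_self, ⟨r, z, by rw [hz]; simp⟩⟩

/-- The limit of a chain of words, each a prefix of the next. -/
theorem exists_limit_of_prefix (L : ℕ → List α) (hL : ∀ n, L n <+: L (n + 1))
    (hl : ∀ n, n < (L n).length) : ∃ v : ℕ → α, ∀ n i, i < (L n).length → (L n)[i]? = some (v i) := by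
  have mono : ∀ m n, m ≤ n → L m <+: L n := fun m n h => by
    induction n, h using Nat.le_induction with
    | base => exact prefix_rfl
    | succ k _ ih => exact ih.trans (hL k)
  refine ⟨fun i => (L i)[i]'(hl i), fun n i hi => ?_⟩
  rw [getElem?_eq_getElem hi]
  rcases le_total n i with h | h
  · rw [(mono n i h).getElem hi]
  · exact congrArg some ((mono i n h).getElem (hl i)).symm

end List

/-! ### Positive words in the free group -/

namespace FreeGroupAut

variable {A : Type*}

/-- The positive element of the free group with letters `w`. -/
def ofList (w : List A) : FreeGroup A := FreeGroup.mk (w.map fun a => (a, true))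

theorem ofList_append (u v : List A) : ofList (u ++ v) = ofList u * ofList v := by
  simp [ofList, FreeGroup.mul_mk]

theorem ofList_nil : ofList ([] : List A) = 1 := rfl

theorem ofList_singleton (a : A) : ofList [a] = FreeGroup.of a := rfl

theorem ofList_cons (a : A) (w : List A) : ofList (a :: w) = FreeGroup.of a * ofList w :=
  ofList_append [a] w

variable [DecidableEq A]

theorem toWord_ofList (w : List A) : (ofList w).toWord = w.map fun a => (a, true) := by
  rw [ofList, FreeGroup.toWord_mk, FreeGroup.IsReduced.reduce_eq]
  rw [FreeGroup.IsReduced, List.isChain_map]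
  simp [List.isChain_iff_getElem]

theorem toWord_ofList_inv (w : List A) :
    (ofList w)⁻¹.toWord = w.reverse.map fun a => (a, false) := by
  simp [FreeGroup.toWord_inv, toWord_ofList, FreeGroup.invRev, Function.comp_def]

theorem map_fst_toWord_ofList (w : List A) : (ofList w).toWord.map Prod.fst = w := by
  simp [toWord_ofList, Function.comp_def]

theorem ofList_injective : Function.Injective (ofList : List A → FreeGroup A) := fun u v h => by
  rw [← map_fst_toWord_ofList u, h, map_fst_toWord_ofList]

theorem isPositiveWord_ofList (w : List A) : IsPositiveWord (ofList w) := by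
  intro l hl
  rw [toWord_ofList] at hl
  obtain ⟨a, -, rfl⟩ := List.mem_map.1 hl
  rfl

theorem IsPositiveWord.eq_ofList {w : FreeGroup A} (h : IsPositiveWord w) :
    w = ofList (w.toWord.map Prod.fst) := by
  conv_lhs => rw [← FreeGroup.mk_toWord (x := w)]
  rw [ofList, List.map_map]
  congr 1
  conv_lhs => rw [← List.map_id w.toWord]
  exact List.map_congr_left fun l hl => Prod.ext rfl (h l hl)

/-- The letters of `φ(a)`. -/
def image (φ : MulAut (FreeGroup A)) (a : A) : List A := (φ (FreeGroup.of a)).toWord.map Prod.fst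

variable {φ ψ : MulAut (FreeGroup A)}

theorem image_eq_of_apply {a : A} {w : List A} (h : φ (FreeGroup.of a) = ofList w) :
    image φ a = w := by
  rw [image, h, map_fst_toWord_ofList]

theorem isPositive_of_apply {f : A → List A} (h : ∀ a, φ (FreeGroup.of a) = ofList (f a)) :
    IsPositive φ := fun a => by
  rw [h]; exact isPositiveWord_ofList _

/-- `image` forgets the signs of the letters; positivity makes this lossless, so that `φ` acts on
positive words as the substitution `List.flatMap (image φ)`. -/
theorem IsPositive.apply_of (h : IsPositive φ) (a : A) :
    φ (FreeGroup.of a) = ofList (image φ a) := (h a).eq_ofList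

theorem IsPositive.apply_ofList (h : IsPositive φ) (w : List A) :
    φ (ofList w) = ofList (w.flatMap (image φ)) := by
  induction w with
  | nil => simp [ofList_nil]
  | cons a t ih => rw [ofList_cons, map_mul, ih, h.apply_of, List.flatMap_cons, ofList_append]

theorem isPositive_one : IsPositive (1 : MulAut (FreeGroup A)) :=
  isPositive_of_apply (f := fun a => [a]) fun _ => rfl

theorem image_one (a : A) : image (1 : MulAut (FreeGroup A)) a = [a] := image_eq_of_apply rfl

theorem flatMap_image_one (w : List A) : w.flatMap (image (1 : MulAut (FreeGroup A))) = w := by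
  rw [List.flatMap_congr fun a _ => image_one a]
  simp

theorem IsPositive.mul_apply (h : IsPositive φ) (h' : IsPositive ψ) (a : A) :
    (φ * ψ) (FreeGroup.of a) = ofList ((image ψ a).flatMap (image φ)) := by
  rw [MulAut.mul_apply, h'.apply_of, h.apply_ofList]

theorem IsPositive.mul (h : IsPositive φ) (h' : IsPositive ψ) : IsPositive (φ * ψ) :=
  isPositive_of_apply (h.mul_apply h')

theorem image_mul (h : IsPositive φ) (h' : IsPositive ψ) (a : A) :
    image (φ * ψ) a = (image ψ a).flatMap (image φ) := image_eq_of_apply (h.mul_apply h' a)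

theorem flatMap_image_mul (h : IsPositive φ) (h' : IsPositive ψ) (w : List A) :
    w.flatMap (image (φ * ψ)) = (w.flatMap (image ψ)).flatMap (image φ) := by
  rw [List.flatMap_assoc]
  exact List.flatMap_congr fun a _ => image_mul h h' a

theorem IsPositive.pow (h : IsPositive φ) (k : ℕ) : IsPositive (φ ^ k) := by
  induction k with
  | zero => rw [pow_zero]; exact isPositive_one
  | succ k ih => rw [pow_succ]; exact ih.mul h

theorem image_ne_nil (φ : MulAut (FreeGroup A)) (a : A) : image φ a ≠ [] := by
  intro h
  rw [image, List.map_eq_nil_iff, FreeGroup.toWord_eq_nil_iff] at h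
  exact FreeGroup.of_ne_one a ((map_eq_one_iff φ φ.injective).1 h)

theorem IsPositive.mem_image_iff (h : IsPositive φ) (a b : A) :
    b ∈ image φ a ↔ (b, true) ∈ (φ (FreeGroup.of a)).toWord := by
  rw [h.apply_of, toWord_ofList]
  simp

end FreeGroupAut

/-! ### Primitive automorphisms -/

namespace FreeGroupAut

variable {A : Type*} [DecidableEq A] {φ : MulAut (FreeGroup A)}

theorem image_pow_add (h : IsPositive φ) (m n : ℕ) (a : A) :
    image (φ ^ (m + n)) a = (image (φ ^ n) a).flatMap (image (φ ^ m)) := by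
  rw [pow_add, image_mul (h.pow m) (h.pow n)]

theorem IsPrimitive.exists_forall_ge (hp : IsPrimitive φ) (h : IsPositive φ) :
    ∃ K, 0 < K ∧ ∀ j, K ≤ j → ∀ a b : A, b ∈ image (φ ^ j) a := by
  obtain ⟨K, hK, hmem⟩ := hp
  refine ⟨K, hK, fun j hj => ?_⟩
  induction j, hj using Nat.le_induction with
  | base => exact fun a b => ((h.pow K).mem_image_iff a b).2 (hmem a b)
  | succ j _ ih =>
    intro a b
    obtain ⟨c, hc⟩ := List.exists_mem_of_ne_nil _ (image_ne_nil (φ ^ 1) a)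
    rw [image_pow_add h]
    exact List.mem_flatMap.2 ⟨c, hc, ih c b⟩

/-- The image of a letter under `φ^K` contains all letters of an alphabet with at least two of them,
so applying `φ^K` lengthens every non-empty word. -/
theorem IsPrimitive.exists_le_length [Nontrivial A] (hp : IsPrimitive φ) (h : IsPositive φ)
    (L : ℕ) : ∃ q, ∀ j, q ≤ j → ∀ a : A, L ≤ (image (φ ^ j) a).length := by
  obtain ⟨K, -, hK⟩ := hp.exists_forall_ge h
  induction L with
  | zero => exact ⟨0, fun _ _ _ => Nat.zero_le _⟩
  | succ L ih =>
    obtain ⟨q, hq⟩ := ih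
    refine ⟨K + q, fun j hj a => ?_⟩
    obtain ⟨i, rfl⟩ := Nat.exists_eq_add_of_le (le_of_add_le_left hj)
    have hi := hq i (by omega) a
    have two : ∀ b, 2 ≤ (image (φ ^ K) b).length := fun b => by
      obtain ⟨c, d, hcd⟩ := exists_pair_ne A
      have h1 := (List.subperm_of_subset (l₁ := [c, d]) (l₂ := image (φ ^ K) b) (by simp [hcd])
        (by simp [hK K le_rfl b])).length_le
      simpa using h1
    rw [image_pow_add h]
    cases e : image (φ ^ i) a with
    | nil => exact absurd e (image_ne_nil _ a)
    | cons c t =>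
      rw [e] at hi
      have h1 := List.length_le_length_flatMap (image_ne_nil (φ ^ K)) t
      have h2 := two c
      simp only [List.flatMap_cons, List.length_append, List.length_cons] at hi ⊢
      omega

/-- Once `φ^q(a) = c b d ⋯`, the letter `a` occurs in `φ^K(b)`, and the non-empty words `φ^K(c)` and
`φ^K(d)` keep it away from both ends of `φ^(K+q)(a)`. -/
theorem IsPrimitive.exists_isSeed [Nontrivial A] (hp : IsPrimitive φ) (h : IsPositive φ) (a : A) :
    ∃ (k : ℕ) (p s : FreeGroup A), IsSeed φ a k p s := by
  obtain ⟨K, hK0, hK⟩ := hp.exists_forall_ge h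
  obtain ⟨q, hq⟩ := hp.exists_le_length h 3
  have h3 := hq q le_rfl a
  obtain ⟨c, b, d, t, e⟩ : ∃ c b d t, image (φ ^ q) a = c :: b :: d :: t := by
    match image (φ ^ q) a, h3 with
    | c :: b :: d :: t, _ => exact ⟨c, b, d, t, rfl⟩
  obtain ⟨u, v, e'⟩ := List.append_of_mem (hK K le_rfl b a)
  refine ⟨K + q, ofList (image (φ ^ K) c ++ u), ofList (v ++ (d :: t).flatMap (image (φ ^ K))),
    by omega, ?_, isPositiveWord_ofList _, ?_, isPositiveWord_ofList _, ?_⟩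
  · rw [← ofList_nil]
    exact ofList_injective.ne (by simp [image_ne_nil])
  · rw [← ofList_nil]
    exact ofList_injective.ne (by simp [image_ne_nil])
  · rw [(h.pow _).apply_of, image_pow_add h, e, ← ofList_singleton, ← ofList_append,
      ← ofList_append]
    simp [e']

end FreeGroupAut

/-! ### Bi-infinite words -/

/-- The factor of length `n` at the place `i` of a bi-infinite word. -/
def biFactor {A : Type*} (W : ℤ → A) (i : ℤ) (n : ℕ) : List A := (List.range n).map fun j : ℕ => W (i + j)

section biFactor

variable {A : Type*}

@[simp]
theorem length_biFactor (W : ℤ → A) (i : ℤ) (n : ℕ) : (biFactor W i n).length = n := by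
  simp [biFactor]

theorem getElem_biFactor (W : ℤ → A) (i : ℤ) (n j : ℕ) (h : j < (biFactor W i n).length) :
    (biFactor W i n)[j] = W (i + j) := by
  simp [biFactor]

theorem biFactor_add (W : ℤ → A) (i : ℤ) (m n : ℕ) :
    biFactor W i (m + n) = biFactor W i m ++ biFactor W (i + m) n := by
  simp [biFactor, List.range_add, Function.comp_def, add_assoc]

theorem biFactor_neg_two_mul (W : ℤ → A) (n : ℕ) :
    biFactor W (-n : ℤ) (2 * n) = biFactor W (-n) n ++ biFactor W 0 n := by
  rw [two_mul, biFactor_add, neg_add_cancel]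

theorem biFactor_succ (W : ℤ → A) (i : ℤ) (n : ℕ) :
    biFactor W i (n + 1) = biFactor W i n ++ [W (i + n)] := by
  rw [biFactor_add]; simp [biFactor]

theorem biFactor_succ' (W : ℤ → A) (i : ℤ) (n : ℕ) :
    biFactor W i (n + 1) = W i :: biFactor W (i + 1) n := by
  rw [add_comm, biFactor_add]; simp [biFactor]

theorem biFactor_eq_iff (V W : ℤ → A) (i k : ℤ) (n : ℕ) :
    biFactor V i n = biFactor W k n ↔ ∀ j < n, V (i + j) = W (k + j) := by
  simp [biFactor]

theorem biFactor_isInfix (W : ℤ → A) {i j : ℤ} {m n : ℕ} (h : i ≤ j) (h' : j + m ≤ i + n) :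
    biFactor W j m <:+: biFactor W i n := by
  obtain ⟨p, rfl⟩ := Int.le.dest h
  obtain ⟨q, rfl⟩ := Nat.exists_eq_add_of_le (show p + m ≤ n by omega)
  rw [biFactor_add, biFactor_add]
  exact List.infix_append _ _ _

theorem eq_biFactor_of_isInfix {W : ℤ → A} {i : ℤ} {n : ℕ} {w : List A}
    (h : w <:+: biFactor W i n) : ∃ j, w = biFactor W j w.length := by
  obtain ⟨u, v, e⟩ := h
  have hn : n = u.length + w.length + v.length := by
    simpa [add_assoc] using (congrArg List.length e).symm
  rw [hn, biFactor_add, biFactor_add] at e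
  obtain ⟨e1, -⟩ := List.append_inj e (by simp)
  exact ⟨_, (List.append_inj e1 (by simp)).2⟩

end biFactor

/-! ### Orbit closures in the double boundary -/

namespace DoubleBoundary

open FreeBoundary Filter Topology

variable {A : Type*}

/-- The pair `(X, Y)` with `X⁻¹ Y` the bi-infinite word `W`. -/
def ofBiinfinite (W : ℤ → A) : DoubleBoundary A :=
  ⟨(⟨fun i => (W (Int.negSucc i), false), fun i => by simp [invLetter]⟩,
    ⟨fun i => (W i, true), fun i => by simp [invLetter]⟩), fun h => by
      have := congrArg (fun V : FreeBoundary A => (V.letter 0).2) h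
      simp [letter] at this⟩

theorem eq_ofBiinfinite {P : DoubleBoundary A} (h : ∀ n, (P.1.1.letter n).2 = false)
    (h' : ∀ n, (P.1.2.letter n).2 = true) : ∃ W, P = ofBiinfinite W := by
  refine ⟨fun i => match i with
    | Int.ofNat n => (P.1.2.letter n).1
    | Int.negSucc n => (P.1.1.letter n).1, ?_⟩
  apply Subtype.ext
  apply Prod.ext
  · exact Subtype.ext (funext fun n => Prod.ext rfl (h n))
  · exact Subtype.ext (funext fun n => Prod.ext rfl (h' n))

theorem shift_ofBiinfinite (W : ℤ → A) :
    shift (ofBiinfinite W) = ofBiinfinite fun i => W (i + 1) := by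
  apply Subtype.ext
  apply Prod.ext
  · change FreeBoundary.letterMul _ _ = _
    rw [FreeBoundary.letterMul, dif_neg (by simp [ofBiinfinite, letter, invLetter])]
    apply Subtype.ext
    funext i
    cases i <;> rfl
  · change FreeBoundary.letterMul _ _ = _
    rw [FreeBoundary.letterMul, dif_pos (by simp [ofBiinfinite, letter, invLetter])]
    apply Subtype.ext
    funext i
    rfl

theorem unshift_ofBiinfinite (W : ℤ → A) :
    unshift (ofBiinfinite W) = ofBiinfinite fun i => W (i - 1) := by
  apply Subtype.ext
  apply Prod.ext
  · change FreeBoundary.letterMul _ _ = _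
    rw [FreeBoundary.letterMul, dif_pos (by simp [ofBiinfinite, letter, invLetter])]
    apply Subtype.ext
    funext i
    rfl
  · change FreeBoundary.letterMul _ _ = _
    rw [FreeBoundary.letterMul, dif_neg (by simp [ofBiinfinite, letter, invLetter])]
    apply Subtype.ext
    funext i
    cases i with
    | zero => rfl
    | succ i =>
      change (W i, true) = (W ((i + 1 : ℕ) - 1), true)
      simp

theorem orbit_ofBiinfinite (W : ℤ → A) :
    orbit (ofBiinfinite W) = Set.range fun k : ℤ => ofBiinfinite fun i => W (i + k) := by
  have h1 : ∀ n : ℕ, shift^[n] (ofBiinfinite W) = ofBiinfinite fun i => W (i + n) := fun n => by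
    induction n with
    | zero => simp
    | succ n ih =>
      rw [Function.iterate_succ_apply', ih, shift_ofBiinfinite]
      congr 1; funext i; congr 1; push_cast; ring
  have h2 : ∀ n : ℕ, unshift^[n] (ofBiinfinite W) = ofBiinfinite fun i => W (i - n) := fun n => by
    induction n with
    | zero => simp
    | succ n ih =>
      rw [Function.iterate_succ_apply', ih, unshift_ofBiinfinite]
      congr 1; funext i; congr 1; push_cast; ring
  ext P
  constructor
  · rintro ⟨n, rfl | rfl⟩
    · exact ⟨n, (h1 n).symm⟩
    · exact ⟨-n, (h2 n).symm⟩
  · rintro ⟨k, rfl⟩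
    obtain ⟨n, rfl | rfl⟩ := k.eq_nat_or_neg
    · exact ⟨n, Or.inl (h1 n).symm⟩
    · exact ⟨n, Or.inr (h2 n).symm⟩

theorem _root_.FreeBoundary.tendsto_of_letter_eq {Q : ℕ → FreeBoundary A} {Z : FreeBoundary A}
    (h : ∀ n, ∀ i < n, (Q n).letter i = Z.letter i) : Tendsto Q atTop (𝓝 Z) := by
  -- The discrete topology on letters is written into the definition of the topology of `∂F` and has
  -- to be named again here.
  let _ : TopologicalSpace (A × Bool) := ⊥
  rw [nhds_induced, tendsto_comap_iff]
  refine tendsto_pi_nhds.2 fun i => tendsto_const_nhds.congr' ?_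
  filter_upwards [eventually_gt_atTop i] with n hn
  exact (h n i hn).symm

theorem _root_.FreeBoundary.isOpen_letter_eq (Z : FreeBoundary A) (i : ℕ) :
    IsOpen {Q : FreeBoundary A | Q.letter i = Z.letter i} := by
  let _ : TopologicalSpace (A × Bool) := ⊥
  have : DiscreteTopology (A × Bool) := ⟨rfl⟩
  have h : Continuous fun Q : FreeBoundary A => Q.letter i :=
    (continuous_apply (A := fun _ : ℕ => A × Bool) i).comp continuous_induced_dom
  exact (isOpen_discrete {Z.letter i}).preimage h

theorem mem_closure_iff_letter {S : Set (DoubleBoundary A)} {Z : DoubleBoundary A} :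
    Z ∈ closure S ↔ ∀ n : ℕ, ∃ Q ∈ S, ∀ i < n,
      Q.1.1.letter i = Z.1.1.letter i ∧ Q.1.2.letter i = Z.1.2.letter i := by
  constructor
  · intro h n
    have ho : IsOpen (⋂ i ∈ Finset.range n, {Q : DoubleBoundary A |
        Q.1.1.letter i = Z.1.1.letter i ∧ Q.1.2.letter i = Z.1.2.letter i}) :=
      isOpen_biInter_finset fun i _ =>
        ((FreeBoundary.isOpen_letter_eq Z.1.1 i).preimage
          (continuous_fst.comp continuous_subtype_val)).inter
        ((FreeBoundary.isOpen_letter_eq Z.1.2 i).preimage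
          (continuous_snd.comp continuous_subtype_val))
    obtain ⟨Q, hQ, hS⟩ := mem_closure_iff.1 h _ ho (by simp)
    exact ⟨Q, hS, fun i hi => by simpa using Set.mem_iInter₂.1 hQ i (Finset.mem_range.2 hi)⟩
  · intro h
    choose Q hS hQ using h
    refine mem_closure_of_tendsto (f := Q) (b := atTop) ?_ (Eventually.of_forall hS)
    rw [tendsto_subtype_rng]
    exact Tendsto.prodMk_nhds (FreeBoundary.tendsto_of_letter_eq fun n i hi => (hQ n i hi).1)
      (FreeBoundary.tendsto_of_letter_eq fun n i hi => (hQ n i hi).2)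

/-- A basic neighbourhood prescribes the first `n` letters of both coordinates, that is, the factor
of the bi-infinite word on the places from `-n` to `n - 1`; moving along the orbit slides this
window. -/
theorem closure_orbit_ofBiinfinite (W : ℤ → A) :
    closure (orbit (ofBiinfinite W)) =
      ofBiinfinite '' {V | ∀ n : ℕ, ∃ k, biFactor V (-n) (2 * n) = biFactor W k (2 * n)} := by
  rw [orbit_ofBiinfinite]
  ext P
  rw [mem_closure_iff_letter]
  constructor
  · intro h
    obtain ⟨V, rfl⟩ : ∃ V, P = ofBiinfinite V := by
      -- The signs of the letters pass to the closure: the `n`-th letters of `P` are those of some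
      -- point of the orbit.
      apply eq_ofBiinfinite <;> intro n <;> obtain ⟨_, ⟨k, rfl⟩, h⟩ := h (n + 1)
      · rw [← (h n n.lt_succ_self).1]; rfl
      · rw [← (h n n.lt_succ_self).2]; rfl
    refine ⟨V, fun n => ?_, rfl⟩
    obtain ⟨_, ⟨k, rfl⟩, h⟩ := h n
    refine ⟨-n + k, (biFactor_eq_iff _ _ _ _ _).2 fun j hj => ?_⟩
    rcases lt_or_ge j n with hjn | hjn
    · have h1 : W (Int.negSucc (n - 1 - j) + k) = V (Int.negSucc (n - 1 - j)) :=
        congrArg Prod.fst (h (n - 1 - j) (by omega)).1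
      have e : Int.negSucc (n - 1 - j) = -n + j := by omega
      rw [e] at h1
      rw [← h1]; congr 1; ring
    · have h1 : W ((j - n : ℕ) + k) = V (j - n : ℕ) :=
        congrArg Prod.fst (h (j - n) (by omega)).2
      have e : ((j - n : ℕ) : ℤ) = -n + j := by omega
      rw [e] at h1
      rw [← h1]; congr 1; ring
  · rintro ⟨V, hV, rfl⟩ n
    obtain ⟨k, hk⟩ := hV n
    rw [biFactor_eq_iff] at hk
    refine ⟨_, ⟨k + n, rfl⟩, fun i hi => ⟨Prod.ext ?_ rfl, Prod.ext ?_ rfl⟩⟩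
    · have h1 := hk (n - 1 - i) (by omega)
      have e : -(n : ℤ) + (n - 1 - i : ℕ) = Int.negSucc i := by omega
      have e' : k + (n - 1 - i : ℕ) = Int.negSucc i + (k + n) := by omega
      rw [e, e'] at h1
      exact h1.symm
    · have h1 := hk (n + i) (by omega)
      have e : -(n : ℤ) + (n + i : ℕ) = i := by omega
      have e' : k + (n + i : ℕ) = i + (k + n) := by omega
      rw [e, e'] at h1
      exact h1.symm

end DoubleBoundary

/-! ### The limit words of a seed -/

namespace FreeGroupAut

open DoubleBoundary

variable {A : Type*}

theorem iteratedWord_succ (φ : MulAut (FreeGroup A)) (k : ℕ) (w : FreeGroup A) (n : ℕ) :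
    iteratedWord φ k w (n + 1) = iteratedWord φ k w n * (φ ^ ((n + 1) * k)) w := by
  rw [iteratedWord, List.range_succ]
  simp [iteratedWord]

variable [DecidableEq A]

/-- The word `φⁿᵏ(P) ⋯ φᵏ(P) P`. -/
def leftWord (φ : MulAut (FreeGroup A)) (k : ℕ) (P : List A) : ℕ → List A
  | 0 => P
  | n + 1 => P.flatMap (image (φ ^ ((n + 1) * k))) ++ leftWord φ k P n

/-- The word `S φᵏ(S) ⋯ φⁿᵏ(S)`. -/
def rightWord (φ : MulAut (FreeGroup A)) (k : ℕ) (S : List A) : ℕ → List A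
  | 0 => S
  | n + 1 => rightWord φ k S n ++ S.flatMap (image (φ ^ ((n + 1) * k)))

variable {φ : MulAut (FreeGroup A)} {k : ℕ} {P S : List A}

theorem iteratedWord_ofList (h : IsPositive φ) (n : ℕ) :
    iteratedWord φ k (ofList S) n = ofList (rightWord φ k S n) := by
  induction n with
  | zero => simp [iteratedWord, rightWord]
  | succ n ih => rw [iteratedWord_succ, ih, (h.pow _).apply_ofList, rightWord, ofList_append]

theorem iteratedWord_ofList_inv (h : IsPositive φ) (n : ℕ) :
    iteratedWord φ k (ofList P)⁻¹ n = (ofList (leftWord φ k P n))⁻¹ := by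
  induction n with
  | zero => simp [iteratedWord, leftWord]
  | succ n ih =>
    rw [iteratedWord_succ, ih, map_inv, (h.pow _).apply_ofList, leftWord, ofList_append,
      mul_inv_rev]

theorem lt_length_leftWord (hP : P ≠ []) (n : ℕ) : n < (leftWord φ k P n).length := by
  induction n with
  | zero => exact List.length_pos_iff.2 hP
  | succ n ih =>
    have := List.length_pos_iff.2
      (List.flatMap_ne_nil_of_ne_nil (image_ne_nil (φ ^ ((n + 1) * k))) hP)
    rw [leftWord, List.length_append]
    omega

theorem lt_length_rightWord (hS : S ≠ []) (n : ℕ) : n < (rightWord φ k S n).length := by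
  induction n with
  | zero => exact List.length_pos_iff.2 hS
  | succ n ih =>
    have := List.length_pos_iff.2
      (List.flatMap_ne_nil_of_ne_nil (image_ne_nil (φ ^ ((n + 1) * k))) hS)
    rw [rightWord, List.length_append]
    omega

/-- Applying `φ^((n+1)k)` to `φ^k(a) = P a S` adds one factor at each end. The images of `a` are
thus nested windows around the same occurrence of `a`. -/
theorem image_pow_succ_mul {a : A} (h : IsPositive φ) (ha : image (φ ^ k) a = P ++ a :: S) (n : ℕ) :
    image (φ ^ ((n + 1) * k)) a = leftWord φ k P n ++ a :: rightWord φ k S n := by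
  induction n with
  | zero => simpa [leftWord, rightWord] using ha
  | succ n ih =>
    rw [add_mul, one_mul, image_pow_add h, ha, List.flatMap_append, List.flatMap_cons, ih]
    simp [leftWord, rightWord]

theorem IsSeed.exists_limit {a : A} {p s : FreeGroup A} (hs : IsSeed φ a k p s)
    (h : IsPositive φ) : ∃ W : ℤ → A, IsLimitPoint φ a k p s (ofBiinfinite W) ∧
      ∀ w : List A, (∃ i, w = biFactor W i w.length) ↔ ∃ n, w <:+: image (φ ^ (n * k)) a := by
  obtain ⟨P, rfl⟩ : ∃ P, p = ofList P := ⟨_, hs.prefix_pos.eq_ofList⟩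
  obtain ⟨S, rfl⟩ : ∃ S, s = ofList S := ⟨_, hs.suffix_pos.eq_ofList⟩
  have hP : P ≠ [] := by rintro rfl; exact hs.prefix_ne rfl
  have hS : S ≠ [] := by rintro rfl; exact hs.suffix_ne rfl
  have ha : image (φ ^ k) a = P ++ a :: S := image_eq_of_apply (by
    rw [hs.eq, ofList_append, ofList_cons, mul_assoc])
  -- The left words grow to the left, so they form a chain of prefixes only after reversal.
  obtain ⟨x, hx⟩ := List.exists_limit_of_prefix (fun n => (leftWord φ k P n).reverse)
    (fun n => by simp [leftWord]) (fun n => by simpa using lt_length_leftWord hP n)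
  obtain ⟨y, hy⟩ := List.exists_limit_of_prefix (fun n => a :: rightWord φ k S n)
    (fun n => by simp [rightWord])
    (fun n => by have := lt_length_rightWord (φ := φ) (k := k) hS n; simp; omega)
  set W : ℤ → A := fun i => match i with
    | Int.ofNat n => y n
    | Int.negSucc n => x n with hW
  have key : ∀ n, biFactor W (-(leftWord φ k P n).length)
      ((leftWord φ k P n).length + ((rightWord φ k S n).length + 1)) =
        image (φ ^ ((n + 1) * k)) a := fun n => by
    rw [image_pow_succ_mul h ha, biFactor_add]
    congr 1
    · refine List.ext_getElem (by simp) fun i hi hi' => ?_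
      rw [getElem_biFactor]
      have h1 := hx n ((leftWord φ k P n).length - 1 - i) (by simp; omega)
      rw [List.getElem?_reverse (by omega), List.getElem?_eq_getElem (by omega)] at h1
      have e : -((leftWord φ k P n).length : ℤ) + i =
          Int.negSucc ((leftWord φ k P n).length - 1 - i) := by omega
      rw [e]
      change x _ = _
      rw [← Option.some.inj h1]
      congr 1
      omega
    · rw [neg_add_cancel]
      refine List.ext_getElem (by simp) fun i hi hi' => ?_
      rw [getElem_biFactor, zero_add]
      have h1 := hy n i hi'
      rw [List.getElem?_eq_getElem hi'] at h1
      exact (Option.some.inj h1).symm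
  refine ⟨W, ⟨fun i => ?_, fun i => ?_⟩, fun w => ⟨?_, ?_⟩⟩
  · filter_upwards [Filter.eventually_ge_atTop i] with n hn
    rw [iteratedWord_ofList_inv h, toWord_ofList_inv, List.getElem?_map,
      hx n i (by simpa using hn.trans_lt (lt_length_leftWord hP n))]
    rfl
  · filter_upwards [Filter.eventually_ge_atTop i] with n hn
    have := lt_length_rightWord (φ := φ) (k := k) hS n
    rw [iteratedWord_ofList h, ← ofList_cons, toWord_ofList, List.getElem?_map,
      hy n i (by simp; omega)]
    rfl
  · rintro ⟨i, hi⟩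
    -- The window of index `m` extends more than `m` letters on each side of place `0`, so this one
    -- covers `w` at place `i`.
    refine ⟨i.natAbs + w.length + 1, ?_⟩
    rw [← key, hi, length_biFactor]
    have h1 := lt_length_leftWord (φ := φ) (k := k) hP (i.natAbs + w.length)
    have h2 := lt_length_rightWord (φ := φ) (k := k) hS (i.natAbs + w.length)
    exact biFactor_isInfix W (by omega) (by omega)
  · rintro ⟨n, hn⟩
    cases n with
    | zero =>
      -- The windows start at exponent `k`; the exponent `0` only gives factors of `[a]`, which lies
      -- in `φ^k(a)`.
      have h0 : w <:+: image (φ ^ k) a := by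
        rw [zero_mul, pow_zero, image_one] at hn
        rw [ha]
        exact hn.trans ⟨P, S, by simp⟩
      have h1 := key 0
      rw [zero_add, one_mul] at h1
      rw [← h1] at h0
      exact eq_biFactor_of_isInfix h0
    | succ n =>
      rw [← key] at hn
      exact eq_biFactor_of_isInfix hn

end FreeGroupAut

/-! ### Positions of the intervals -/

section leftEnd

variable {A : Type*} [Fintype A] {N : ℕ}

/-- The left end of the interval with label `a`, the intervals being ordered by `π`. -/
noncomputable def leftEnd (π : A ≃ Fin N) (len : A → ℝ) (a : A) : ℝ :=
  ∑ b with π b < π a, len b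

variable {π : A ≃ Fin N} {len : A → ℝ}

theorem leftEnd_nonneg (hl : ∀ a, 0 < len a) (a : A) : 0 ≤ leftEnd π len a :=
  Finset.sum_nonneg fun b _ => (hl b).le

theorem leftEnd_add_eq_sum (a : A) : leftEnd π len a + len a = ∑ b with π b ≤ π a, len b := by
  classical
  have : (Finset.univ.filter fun b => π b ≤ π a) =
      insert a (Finset.univ.filter fun b => π b < π a) := by
    ext b
    simp [le_iff_lt_or_eq, or_comm]
  rw [this, Finset.sum_insert (by simp), add_comm, leftEnd]

theorem leftEnd_add_le (hl : ∀ a, 0 < len a) {a b : A} (h : π a < π b) :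
    leftEnd π len a + len a ≤ leftEnd π len b := by
  rw [leftEnd_add_eq_sum]
  refine Finset.sum_le_sum_of_subset_of_nonneg (fun c hc => ?_) fun c _ _ => (hl c).le
  simp only [Finset.mem_filter, Finset.mem_univ, true_and] at hc ⊢
  exact hc.trans_lt h

theorem leftEnd_add_of_last {a : A} (h : (π a).val + 1 = N) :
    leftEnd π len a + len a = ∑ b, len b := by
  rw [leftEnd_add_eq_sum, Finset.filter_true_of_mem]
  intro b _
  rw [Fin.le_def]
  omega

theorem leftEnd_add_le_sum (hl : ∀ a, 0 < len a) (a : A) :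
    leftEnd π len a + len a ≤ ∑ b, len b := by
  rw [leftEnd_add_eq_sum]
  exact Finset.sum_le_sum_of_subset_of_nonneg (Finset.filter_subset _ _) fun c _ _ => (hl c).le

variable [DecidableEq A]

/-- The last interval lies to the left of no other one. -/
theorem leftEnd_update_last {w : A} (hw : (π w).val + 1 = N) (c : ℝ) (b : A) :
    leftEnd π (Function.update len w c) b = leftEnd π len b := by
  refine Finset.sum_congr rfl fun d hd => Function.update_of_ne ?_ _ _
  rintro rfl
  simp only [Finset.mem_filter, Finset.mem_univ, true_and, Fin.lt_def] at hd
  omega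

theorem val_moveLastAfter (p j : Fin N) : (moveLastAfter p j).val =
    if j.val ≤ p.val then j.val else if j.val + 1 = N then p.val + 1 else j.val + 1 := by
  simp only [moveLastAfter, Equiv.ofBijective_apply]
  split_ifs <;> rfl

/-- The interval `l` is inserted right after `w`, and `w` is shortened by the length of `l`: for the
intervals beyond `w` the two changes cancel. -/
theorem leftEnd_moveLastAfter_of_ne {w l b : A} (hl : (π l).val + 1 = N) (hwl : w ≠ l)
    (hb : b ≠ l) : leftEnd (π.trans (moveLastAfter (π w)))
      (Function.update len w (len w - len l)) b = leftEnd π len b := by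
  have hval : ∀ c d : A, (π c).val = (π d).val → c = d := fun c d h => π.injective (Fin.ext h)
  have hbl : (π b).val + 1 ≠ N := fun h => hb (hval _ _ (by omega))
  have hwl' : (π w).val + 1 ≠ N := fun h => hwl (hval _ _ (by omega))
  -- The length that the sum up to `b` loses at `w` and regains at `l`.
  set X : ℝ := if π w < π b then len l else 0 with hX
  have key : ∀ c, (if π.trans (moveLastAfter (π w)) c < π.trans (moveLastAfter (π w)) b then
      Function.update len w (len w - len l) c else 0) =
      (if π c < π b then len c else 0) - (if c = w then X else 0) + if c = l then X else 0 := by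
    intro c
    simp only [Equiv.trans_apply, Fin.lt_def, val_moveLastAfter, hX]
    by_cases hcw : c = w
    · subst hcw
      rw [if_neg hwl, if_pos rfl, Function.update_self]
      by_cases h : (π c).val < (π b).val
      · rw [if_pos (by split_ifs <;> omega), if_pos h, if_pos h]; ring
      · rw [if_neg (by split_ifs <;> omega), if_neg h, if_neg h]; ring
    · rw [if_neg hcw, Function.update_of_ne hcw]
      by_cases hcl : c = l
      · subst hcl
        rw [if_pos rfl, if_neg (show ¬ (π c).val < (π b).val by omega)]
        by_cases h : (π w).val < (π b).val
        · rw [if_pos (by split_ifs <;> omega), if_pos h]; ring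
        · rw [if_neg (by split_ifs <;> omega), if_neg h]; ring
      · have hcl' : (π c).val + 1 ≠ N := fun h => hcl (hval _ _ (by omega))
        rw [if_neg hcl]
        by_cases h : (π c).val < (π b).val
        · rw [if_pos (by split_ifs <;> omega), if_pos h]; ring
        · rw [if_neg (by split_ifs <;> omega), if_neg h]; ring
  rw [leftEnd, leftEnd, Finset.sum_filter, Finset.sum_filter, Finset.sum_congr rfl fun c _ => key c]
  simp [Finset.sum_add_distrib, Finset.sum_sub_distrib]

theorem leftEnd_moveLastAfter_last {w l : A} (hl : (π l).val + 1 = N) (hwl : w ≠ l) :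
    leftEnd (π.trans (moveLastAfter (π w))) (Function.update len w (len w - len l)) l =
      leftEnd π len w + len w - len l := by
  have hval : ∀ c d : A, (π c).val = (π d).val → c = d := fun c d h => π.injective (Fin.ext h)
  have hwl' : (π w).val + 1 ≠ N := fun h => hwl (hval _ _ (by omega))
  have key : ∀ c, (if π.trans (moveLastAfter (π w)) c < π.trans (moveLastAfter (π w)) l then
      Function.update len w (len w - len l) c else 0) =
      (if π c < π w then len c else 0) + if c = w then len w - len l else 0 := by
    intro c
    simp only [Equiv.trans_apply, Fin.lt_def, val_moveLastAfter]
    by_cases hcw : c = w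
    · subst hcw
      rw [if_pos rfl, Function.update_self, if_pos (by split_ifs <;> omega), if_neg (by omega)]
      ring
    · rw [if_neg hcw, Function.update_of_ne hcw, add_zero]
      have hcw' : (π c).val ≠ (π w).val := fun h => hcw (hval _ _ h)
      by_cases h : (π c).val < (π w).val
      · rw [if_pos (by split_ifs <;> omega), if_pos h]
      · rw [if_neg (by split_ifs <;> omega), if_neg h]
  rw [leftEnd, leftEnd, Finset.sum_filter, Finset.sum_filter, Finset.sum_congr rfl fun c _ => key c]
  simp [Finset.sum_add_distrib]
  ring

end leftEnd

/-! ### Paths -/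

namespace CIET

variable {A : Type*} {N : ℕ}

theorem perm0_last0 (δ : CIET A N) : (δ.perm0 δ.last0).val + 1 = N := by
  have := δ.two_le
  simp [last0]; omega

theorem perm1_last1 (δ : CIET A N) : (δ.perm1 δ.last1).val + 1 = N := by
  have := δ.two_le
  simp [last1]; omega

theorem eq_last0 (δ : CIET A N) {a : A} (h : (δ.perm0 a).val + 1 = N) : a = δ.last0 :=
  δ.perm0.injective (Fin.ext (by have := δ.perm0_last0; omega))

theorem eq_last1 (δ : CIET A N) {a : A} (h : (δ.perm1 a).val + 1 = N) : a = δ.last1 :=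
  δ.perm1.injective (Fin.ext (by have := δ.perm1_last1; omega))

variable [Fintype A] (δ : CIET A N)

theorem left0_nonneg (a : A) : 0 ≤ δ.left0 a := leftEnd_nonneg δ.len_pos a

theorem left1_nonneg (a : A) : 0 ≤ δ.left1 a := leftEnd_nonneg δ.len_pos a

theorem left0_add_le_total (a : A) : δ.left0 a + δ.len a ≤ δ.total :=
  leftEnd_add_le_sum δ.len_pos a

theorem left1_add_le_total (a : A) : δ.left1 a + δ.len a ≤ δ.total :=
  leftEnd_add_le_sum δ.len_pos a

theorem left0_last0 : δ.left0 δ.last0 + δ.len δ.last0 = δ.total :=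
  leftEnd_add_of_last δ.perm0_last0

theorem left1_last1 : δ.left1 δ.last1 + δ.len δ.last1 = δ.total :=
  leftEnd_add_of_last δ.perm1_last1

theorem left0_add_le_last0 {a : A} (h : a ≠ δ.last0) :
    δ.left0 a + δ.len a ≤ δ.left0 δ.last0 := by
  refine leftEnd_add_le δ.len_pos (Fin.lt_def.2 ?_)
  have h1 := δ.perm0_last0
  have h2 : (δ.perm0 a).val + 1 ≠ N := fun e => h (δ.eq_last0 e)
  omega

theorem left1_add_le_last1 {a : A} (h : a ≠ δ.last1) :
    δ.left1 a + δ.len a ≤ δ.left1 δ.last1 := by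
  refine leftEnd_add_le δ.len_pos (Fin.lt_def.2 ?_)
  have h1 := δ.perm1_last1
  have h2 : (δ.perm1 a).val + 1 ≠ N := fun e => h (δ.eq_last1 e)
  omega

/-- The translations along the letters of the word `w` carry `x` to `y`. -/
def Path : ℝ → List A → ℝ → Prop
  | x, [], y => y = x
  | x, a :: w, y => (δ.left0 a ≤ x ∧ x ≤ δ.left0 a + δ.len a) ∧ Path (x - δ.left0 a + δ.left1 a) w y

/-- The words that label a path. -/
def language : Set (List A) := {w | ∃ x y, δ.Path x w y}

variable {δ}

theorem path_nil {x y : ℝ} : δ.Path x [] y ↔ y = x := Iff.rfl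

theorem path_cons {x y : ℝ} {a : A} {w : List A} : δ.Path x (a :: w) y ↔
    (δ.left0 a ≤ x ∧ x ≤ δ.left0 a + δ.len a) ∧ δ.Path (x - δ.left0 a + δ.left1 a) w y := Iff.rfl

theorem path_singleton {x y : ℝ} {a : A} : δ.Path x [a] y ↔
    (δ.left0 a ≤ x ∧ x ≤ δ.left0 a + δ.len a) ∧ y = x - δ.left0 a + δ.left1 a := Iff.rfl

theorem path_append {u v : List A} {x z : ℝ} :
    δ.Path x (u ++ v) z ↔ ∃ y, δ.Path x u y ∧ δ.Path y v z := by
  induction u generalizing x with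
  | nil => simp [path_nil]
  | cons a t ih => simp [path_cons, ih, and_assoc]

theorem Path.append {u v : List A} {x y z : ℝ} (h : δ.Path x u y) (h' : δ.Path y v z) :
    δ.Path x (u ++ v) z := path_append.2 ⟨y, h, h'⟩

theorem Path.unique {w : List A} {x y z : ℝ} (h : δ.Path x w y) (h' : δ.Path x w z) : y = z := by
  induction w generalizing x with
  | nil => rw [path_nil.1 h, path_nil.1 h']
  | cons a t ih => exact ih h.2 h'.2

/-- The empty path may sit at any real number, so `w ≠ []` is needed. -/
theorem Path.source_mem {w : List A} {x y : ℝ} (hw : w ≠ []) (h : δ.Path x w y) :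
    0 ≤ x ∧ x ≤ δ.total := by
  cases w with
  | nil => exact absurd rfl hw
  | cons a t => exact ⟨(δ.left0_nonneg a).trans h.1.1, h.1.2.trans (δ.left0_add_le_total a)⟩

theorem Path.target_mem_last {w : List A} {a : A} {x y : ℝ} (h : δ.Path x (w ++ [a]) y) :
    δ.left1 a ≤ y ∧ y ≤ δ.left1 a + δ.len a := by
  obtain ⟨z, -, hz, rfl⟩ := path_append.1 h
  constructor <;> linarith [hz.1, hz.2]

theorem Path.target_mem {w : List A} {x y : ℝ} (hw : w ≠ []) (h : δ.Path x w y) :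
    0 ≤ y ∧ y ≤ δ.total := by
  obtain ⟨u, a, rfl⟩ := (List.eq_nil_or_concat' w).resolve_left hw
  have := h.target_mem_last
  exact ⟨(δ.left1_nonneg a).trans this.1, this.2.trans (δ.left1_add_le_total a)⟩

theorem mem_language_of_isInfix {u w : List A} (h : u <:+: w) (hw : w ∈ δ.language) :
    u ∈ δ.language := by
  obtain ⟨r, s, rfl⟩ := h
  obtain ⟨x, y, h⟩ := hw
  obtain ⟨z, h1, -⟩ := path_append.1 h
  obtain ⟨z', -, h2⟩ := path_append.1 h1
  exact ⟨z', z, h2⟩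

theorem singleton_mem_language (a : A) : [a] ∈ δ.language :=
  ⟨δ.left0 a, _, path_singleton.2 ⟨⟨le_rfl, by linarith [δ.len_pos a]⟩, rfl⟩⟩

end CIET

/-! ### One step of the Rauzy induction -/

namespace FreeGroupAut

variable {A : Type*} [DecidableEq A]

theorem rightTwist_apply_of (c u : A) (h : u ≠ c) (a : A) :
    rightTwist c u h (FreeGroup.of a) = ofList (if a = c then [c, u] else [a]) := by
  split_ifs with ha
  · exact FreeGroup.lift_apply_of.trans (if_pos ha)
  · exact FreeGroup.lift_apply_of.trans (if_neg ha)

theorem leftTwist_apply_of (c u : A) (h : u ≠ c) (a : A) :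
    leftTwist c u h (FreeGroup.of a) = ofList (if a = c then [u, c] else [a]) := by
  split_ifs with ha
  · exact FreeGroup.lift_apply_of.trans (if_pos ha)
  · exact FreeGroup.lift_apply_of.trans (if_neg ha)

end FreeGroupAut

namespace CIET

open FreeGroupAut

variable {A : Type*} {N : ℕ} [DecidableEq A] {δ : CIET A N}

theorem rauzy_of_type0 (h : δ.len δ.last1 < δ.len δ.last0) : δ.rauzy = δ.rauzy0 h := dif_pos h

theorem rauzy_of_type1 (h : δ.len δ.last0 < δ.len δ.last1) : δ.rauzy = δ.rauzy1 h := by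
  rw [rauzy, dif_neg h.not_gt, dif_pos h]

theorem twist_apply_of_type0 (h : δ.len δ.last1 < δ.len δ.last0) (a : A) :
    δ.twist (FreeGroup.of a) = ofList (if a = δ.last1 then [δ.last1, δ.last0] else [a]) := by
  rw [twist, dif_pos h, rightTwist_apply_of]

theorem twist_apply_of_type1 (h : δ.len δ.last0 < δ.len δ.last1) (a : A) :
    δ.twist (FreeGroup.of a) = ofList (if a = δ.last0 then [δ.last1, δ.last0] else [a]) := by
  rw [twist, dif_neg h.not_gt, dif_pos h, leftTwist_apply_of]

theorem image_twist_of_type0 (h : δ.len δ.last1 < δ.len δ.last0) (a : A) :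
    image δ.twist a = if a = δ.last1 then [δ.last1, δ.last0] else [a] :=
  image_eq_of_apply (twist_apply_of_type0 h a)

theorem image_twist_of_type1 (h : δ.len δ.last0 < δ.len δ.last1) (a : A) :
    image δ.twist a = if a = δ.last0 then [δ.last1, δ.last0] else [a] :=
  image_eq_of_apply (twist_apply_of_type1 h a)

theorem isPositive_twist (δ : CIET A N) : IsPositive δ.twist := by
  by_cases h : δ.len δ.last1 < δ.len δ.last0
  · exact isPositive_of_apply (twist_apply_of_type0 h)
  · by_cases h' : δ.len δ.last0 < δ.len δ.last1
    · exact isPositive_of_apply (twist_apply_of_type1 h')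
    · rw [twist, dif_neg h, dif_neg h']
      exact isPositive_one

theorem len_rauzy_of_type0 (h : δ.len δ.last1 < δ.len δ.last0) {a : A}
    (ha : a ≠ δ.last0) : δ.rauzy.len a = δ.len a := by
  rw [rauzy_of_type0 h]
  exact Function.update_of_ne ha _ _

theorem len_rauzy_last0_of_type0 (h : δ.len δ.last1 < δ.len δ.last0) :
    δ.rauzy.len δ.last0 = δ.len δ.last0 - δ.len δ.last1 := by
  rw [rauzy_of_type0 h]
  exact Function.update_self _ _ _

theorem len_rauzy_of_type1 (h : δ.len δ.last0 < δ.len δ.last1) {a : A}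
    (ha : a ≠ δ.last1) : δ.rauzy.len a = δ.len a := by
  rw [rauzy_of_type1 h]
  exact Function.update_of_ne ha _ _

theorem len_rauzy_last1_of_type1 (h : δ.len δ.last0 < δ.len δ.last1) :
    δ.rauzy.len δ.last1 = δ.len δ.last1 - δ.len δ.last0 := by
  rw [rauzy_of_type1 h]
  exact Function.update_self _ _ _

variable [Fintype A]

/-! ### Paths under a step of type 0 -/

section Type0

variable (h : δ.len δ.last1 < δ.len δ.last0)

include h

theorem left0_rauzy_of_type0 (a : A) : δ.rauzy.left0 a = δ.left0 a := by
  rw [rauzy_of_type0 h]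
  exact leftEnd_update_last δ.perm0_last0 _ _

theorem left1_rauzy_of_type0 {a : A} (ha : a ≠ δ.last1) : δ.rauzy.left1 a = δ.left1 a := by
  rw [rauzy_of_type0 h]
  exact leftEnd_moveLastAfter_of_ne δ.perm1_last1 (δ.last1_ne_last0_of_lt h) ha

theorem left1_rauzy_last1_of_type0 : δ.rauzy.left1 δ.last1 =
    δ.left1 δ.last0 + δ.len δ.last0 - δ.len δ.last1 := by
  rw [rauzy_of_type0 h]
  exact leftEnd_moveLastAfter_last δ.perm1_last1 (δ.last1_ne_last0_of_lt h)

/-- `δ` sends the interval of `α₁` to the right end of the domain, inside the longer interval of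
`α₀`; applying `α₀` next gives exactly the new translation of `α₁`. -/
theorem path_image_of_type0 {x y : ℝ} {a : A} (hp : δ.rauzy.Path x [a] y) :
    δ.Path x (image δ.twist a) y := by
  rw [path_singleton, left0_rauzy_of_type0 h] at hp
  rw [image_twist_of_type0 h]
  by_cases ha : a = δ.last1
  · subst ha
    have hne := (δ.last1_ne_last0_of_lt h).symm
    rw [left1_rauzy_last1_of_type0 h, len_rauzy_of_type0 h hne] at hp
    obtain ⟨⟨h1, h2⟩, rfl⟩ := hp
    have := δ.left0_last0
    have := δ.left1_last1
    rw [if_pos rfl]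
    refine ⟨⟨h1, h2⟩, ⟨by linarith, by linarith⟩, ?_⟩
    rw [path_nil]
    linarith
  · rw [left1_rauzy_of_type0 h ha] at hp
    rw [if_neg ha, path_singleton]
    refine ⟨⟨hp.1.1, hp.1.2.trans ?_⟩, hp.2⟩
    by_cases ha0 : a = δ.last0
    · subst ha0
      rw [len_rauzy_last0_of_type0 h]
      linarith [δ.len_pos δ.last1]
    · rw [len_rauzy_of_type0 h ha0]

/-- The word is decoded from left to right, each `α₁` being read with the `α₀` that must follow it.
The point stays in the domain `[0, |λ| - λ_{α₁}]` of `R(δ)`, and a final `α₁` is excluded because it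
would be half a block. The bound on the length serves the induction, as a block may use two letters.
-/
theorem exists_path_rauzy_of_type0 : ∀ (n : ℕ) {u : List A} {x y : ℝ}, u.length ≤ n →
    δ.Path x u y → x + δ.len δ.last1 ≤ δ.total → (∀ v, u ≠ v ++ [δ.last1]) →
      ∃ u', δ.rauzy.Path x u' y ∧ u'.flatMap (image δ.twist) = u := by
  have hne := δ.last1_ne_last0_of_lt h
  have e0 := δ.left0_last0
  have e1 := δ.left1_last1
  intro n
  induction n with
  | zero =>
    intro u x y hu hp _ _
    obtain rfl := List.length_eq_zero_iff.1 (Nat.le_zero.1 hu)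
    exact ⟨[], hp, rfl⟩
  | succ n ih =>
    intro u x y hu hp hx hend
    cases u with
    | nil => exact ⟨[], hp, rfl⟩
    | cons b t =>
      obtain ⟨⟨h1, h2⟩, hp⟩ := hp
      by_cases hb : b = δ.last1
      · subst hb
        cases t with
        | nil => exact absurd rfl (hend [])
        | cons c t =>
          obtain ⟨⟨h3, h4⟩, hp⟩ := hp
          -- After `α₁` the point is at least `|λ| - λ_{α₁}`, strictly to the right of all the
          -- intervals other than that of `α₀`.
          obtain rfl : c = δ.last0 := by
            by_contra hc
            have := δ.left0_add_le_last0 hc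
            linarith
          obtain ⟨u', hu', e⟩ := ih (by simp at hu ⊢; omega) hp (by
            have := δ.left1_add_le_last1 hne
            linarith) fun v hv => hend (δ.last1 :: δ.last0 :: v) (by rw [hv]; rfl)
          refine ⟨δ.last1 :: u', path_cons.2 ⟨?_, ?_⟩, ?_⟩
          · rw [left0_rauzy_of_type0 h, len_rauzy_of_type0 h hne.symm]
            exact ⟨h1, h2⟩
          · rw [left0_rauzy_of_type0 h, left1_rauzy_last1_of_type0 h]
            convert hu' using 1
            linarith
          · simp [e, image_twist_of_type0 h]
      · have hlen : x ≤ δ.left0 b + δ.rauzy.len b := by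
          by_cases hb0 : b = δ.last0
          · subst hb0
            rw [len_rauzy_last0_of_type0 h]
            linarith
          · rw [len_rauzy_of_type0 h hb0]
            exact h2
        obtain ⟨u', hu', e⟩ := ih (by simpa using hu) hp (by
          have := δ.left1_add_le_last1 hb
          linarith) fun v hv => hend (b :: v) (by rw [hv]; rfl)
        refine ⟨b :: u', path_cons.2 ⟨?_, ?_⟩, ?_⟩
        · rw [left0_rauzy_of_type0 h]
          exact ⟨h1, hlen⟩
        · rw [left0_rauzy_of_type0 h, left1_rauzy_of_type0 h hb]
          exact hu'
        · simp [e, image_twist_of_type0 h, hb]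

/-- A starting point outside the domain of `R(δ)` is an image under `α₁`, which is put in front;
after a final `α₁` the letter `α₀` is added. The path along `r` is kept in order to locate the
points of the original path in the extended one. -/
theorem exists_extension_of_type0 {u : List A} {x y : ℝ} (hu : u ≠ []) (hp : δ.Path x u y) :
    ∃ (r s u' : List A) (x' y' : ℝ), δ.rauzy.Path x' u' y' ∧
      u'.flatMap (image δ.twist) = r ++ u ++ s ∧ δ.Path x' r x := by
  have hne := δ.last1_ne_last0_of_lt h
  have e0 := δ.left0_last0
  have e1 := δ.left1_last1
  have hl := δ.left0_add_le_last0 hne.symm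
  obtain ⟨r, x', hr, hx'⟩ : ∃ r x', δ.Path x' r x ∧ x' + δ.len δ.last1 ≤ δ.total := by
    rcases le_or_gt (x + δ.len δ.last1) δ.total with hx | hx
    · exact ⟨[], x, rfl, hx⟩
    · have := (hp.source_mem hu).2
      refine ⟨[δ.last1], x - δ.left1 δ.last1 + δ.left0 δ.last1,
        path_singleton.2 ⟨⟨by linarith, by linarith⟩, by ring⟩, by linarith⟩
  obtain ⟨s, y', hs, hend⟩ : ∃ s y', δ.Path y s y' ∧ ∀ v, r ++ u ++ s ≠ v ++ [δ.last1] := by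
    by_cases hu' : ∃ v, u = v ++ [δ.last1]
    · obtain ⟨v, rfl⟩ := hu'
      have := hp.target_mem_last
      refine ⟨[δ.last0], _, path_singleton.2 ⟨⟨by linarith, by linarith⟩, rfl⟩, fun v' e => ?_⟩
      have := (List.append_inj' e rfl).2
      simp at this
      exact hne this
    · refine ⟨[], y, rfl, fun v e => hu' ?_⟩
      obtain ⟨t, a, rfl⟩ := (List.eq_nil_or_concat' u).resolve_left hu
      rw [List.append_nil, ← List.append_assoc] at e
      exact ⟨t, by rw [(List.append_inj' e rfl).2]⟩
  obtain ⟨u', hu', e⟩ := exists_path_rauzy_of_type0 h _ le_rfl ((hr.append hp).append hs) hx' hend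
  exact ⟨r, s, u', x', y', hu', e, hr⟩

end Type0

/-! ### Paths under a step of type 1 -/

section Type1

variable (h : δ.len δ.last0 < δ.len δ.last1)

include h

theorem left1_rauzy_of_type1 (a : A) : δ.rauzy.left1 a = δ.left1 a := by
  rw [rauzy_of_type1 h]
  exact leftEnd_update_last δ.perm1_last1 _ _

theorem left0_rauzy_of_type1 {a : A} (ha : a ≠ δ.last0) : δ.rauzy.left0 a = δ.left0 a := by
  rw [rauzy_of_type1 h]
  exact leftEnd_moveLastAfter_of_ne δ.perm0_last0 (δ.last0_ne_last1_of_lt h) ha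

theorem left0_rauzy_last0_of_type1 : δ.rauzy.left0 δ.last0 =
    δ.left0 δ.last1 + δ.len δ.last1 - δ.len δ.last0 := by
  rw [rauzy_of_type1 h]
  exact leftEnd_moveLastAfter_last δ.perm0_last0 (δ.last0_ne_last1_of_lt h)

theorem path_image_of_type1 {x y : ℝ} {a : A} (hp : δ.rauzy.Path x [a] y) :
    δ.Path x (image δ.twist a) y := by
  rw [path_singleton, left1_rauzy_of_type1 h] at hp
  rw [image_twist_of_type1 h]
  by_cases ha : a = δ.last0
  · subst ha
    have hne := (δ.last0_ne_last1_of_lt h).symm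
    rw [left0_rauzy_last0_of_type1 h, len_rauzy_of_type1 h hne] at hp
    obtain ⟨⟨h1, h2⟩, rfl⟩ := hp
    have := δ.left0_last0
    have := δ.left1_last1
    rw [if_pos rfl]
    refine ⟨⟨by linarith, by linarith⟩, ⟨by linarith, by linarith⟩, ?_⟩
    rw [path_nil]
    linarith
  · rw [left0_rauzy_of_type1 h ha] at hp
    rw [if_neg ha, path_singleton]
    refine ⟨⟨hp.1.1, hp.1.2.trans ?_⟩, hp.2⟩
    by_cases ha1 : a = δ.last1
    · subst ha1
      rw [len_rauzy_last1_of_type1 h]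
      linarith [δ.len_pos δ.last0]
    · rw [len_rauzy_of_type1 h ha1]

/-- Here it is `α₀` that must be preceded by `α₁`. The conditions at the ends are therefore those of
type 0 reversed: the target lies in the domain `[0, |λ| - λ_{α₀}]` of `R(δ)`, and the word does not
start with half a block. -/
theorem exists_path_rauzy_of_type1 : ∀ (n : ℕ) {u : List A} {x y : ℝ}, u.length ≤ n →
    δ.Path x u y → y + δ.len δ.last0 ≤ δ.total → (∀ v, u ≠ δ.last0 :: v) →
      ∃ u', δ.rauzy.Path x u' y ∧ u'.flatMap (image δ.twist) = u := by
  have hne := δ.last0_ne_last1_of_lt h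
  have e0 := δ.left0_last0
  have e1 := δ.left1_last1
  intro n
  induction n with
  | zero =>
    intro u x y hu hp _ _
    obtain rfl := List.length_eq_zero_iff.1 (Nat.le_zero.1 hu)
    exact ⟨[], hp, rfl⟩
  | succ n ih =>
    intro u x y hu hp hy hstart
    cases u with
    | nil => exact ⟨[], hp, rfl⟩
    | cons b t =>
      have hb : b ≠ δ.last0 := fun e => hstart t (by rw [e])
      obtain ⟨⟨h1, h2⟩, hp⟩ := hp
      by_cases ht : ∃ t', t = δ.last0 :: t'
      · obtain ⟨t, rfl⟩ := ht
        obtain ⟨⟨h3, h4⟩, hp⟩ := hp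
        -- Only `α₁` has an image reaching the interval of `α₀`.
        obtain rfl : b = δ.last1 := by
          by_contra hc
          have := δ.left1_add_le_last1 hc
          linarith
        have hl := δ.left1_add_le_last1 hne.symm
        -- A second `α₀` cannot follow: the image of `α₀` ends before the image of `α₁` starts,
        -- hence strictly before the interval of `α₀`.
        obtain ⟨u', hu', e⟩ := ih (by simp at hu ⊢; omega) hp hy (by
          rintro v rfl
          have := hp.1.1
          linarith)
        refine ⟨δ.last0 :: u', path_cons.2 ⟨?_, ?_⟩, ?_⟩
        · rw [left0_rauzy_last0_of_type1 h, len_rauzy_of_type1 h hne.symm]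
          constructor <;> linarith
        · rw [left0_rauzy_last0_of_type1 h, left1_rauzy_of_type1 h]
          convert hu' using 1
          linarith
        · simp [e, image_twist_of_type1 h]
      -- The next point lies in the domain of `R(δ)`: either it is the target, or the next letter is
      -- not `α₀`. For `b = α₁` this bounds `x` by the end of the shortened interval.
      · have hx1 : x - δ.left0 b + δ.left1 b + δ.len δ.last0 ≤ δ.total := by
          cases t with
          | nil => rw [path_nil] at hp; rw [← hp]; exact hy
          | cons c t =>
            have hc : c ≠ δ.last0 := fun e => ht ⟨t, by rw [e]⟩
            have := δ.left0_add_le_last0 hc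
            linarith [hp.1.2]
        have hlen : x ≤ δ.left0 b + δ.rauzy.len b := by
          by_cases hb1 : b = δ.last1
          · subst hb1
            rw [len_rauzy_last1_of_type1 h]
            linarith
          · rw [len_rauzy_of_type1 h hb1]
            exact h2
        obtain ⟨u', hu', e⟩ := ih (by simpa using hu) hp hy fun v hv => ht ⟨v, hv⟩
        refine ⟨b :: u', path_cons.2 ⟨?_, ?_⟩, ?_⟩
        · rw [left0_rauzy_of_type1 h hb]
          exact ⟨h1, hlen⟩
        · rw [left0_rauzy_of_type1 h hb, left1_rauzy_of_type1 h]
          exact hu'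
        · simp [e, image_twist_of_type1 h, hb]

theorem exists_extension_of_type1 {u : List A} {x y : ℝ} (hu : u ≠ []) (hp : δ.Path x u y) :
    ∃ (r s u' : List A) (x' y' : ℝ), δ.rauzy.Path x' u' y' ∧
      u'.flatMap (image δ.twist) = r ++ u ++ s ∧ δ.Path x' r x := by
  have hne := δ.last0_ne_last1_of_lt h
  have e0 := δ.left0_last0
  have e1 := δ.left1_last1
  have hl := δ.left1_add_le_last1 hne.symm
  obtain ⟨r, x', hr, hstart⟩ : ∃ r x', δ.Path x' r x ∧ ∀ v, r ++ u ≠ δ.last0 :: v := by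
    by_cases hu' : ∃ v, u = δ.last0 :: v
    · obtain ⟨v, rfl⟩ := hu'
      have h1 := hp.1.1
      have h2 := hp.1.2
      refine ⟨[δ.last1], x - δ.left1 δ.last1 + δ.left0 δ.last1,
        path_singleton.2 ⟨⟨by linarith, by linarith⟩, by ring⟩, fun v' e => hne ?_⟩
      exact (List.cons.inj e).1
    · exact ⟨[], x, rfl, fun v e => hu' ⟨v, e⟩⟩
  obtain ⟨s, y', hs, hy'⟩ : ∃ s y', δ.Path y s y' ∧ y' + δ.len δ.last0 ≤ δ.total := by
    rcases le_or_gt (y + δ.len δ.last0) δ.total with hy | hy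
    · exact ⟨[], y, rfl, hy⟩
    · have := (hp.target_mem hu).2
      refine ⟨[δ.last0], _, path_singleton.2 ⟨⟨by linarith, by linarith⟩, rfl⟩, by linarith⟩
  obtain ⟨u', hu', e⟩ := exists_path_rauzy_of_type1 h _ le_rfl ((hr.append hp).append hs) hy'
    fun v e => by
      obtain ⟨a, t, e'⟩ := List.exists_cons_of_ne_nil (l := r ++ u) (by simp [hu])
      rw [e', List.cons_append] at e
      exact hstart t (by rw [e', (List.cons.inj e).1])
  exact ⟨r, s, u', x', y', hu', e, hr⟩

end Type1

theorem Inducible.path_image (hi : δ.Inducible) {x y : ℝ} {w : List A}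
    (hp : δ.rauzy.Path x w y) : δ.Path x (w.flatMap (image δ.twist)) y := by
  induction w generalizing x with
  | nil => exact hp
  | cons a t ih =>
    obtain ⟨z, h1, h2⟩ := path_append.1 (show δ.rauzy.Path x ([a] ++ t) y from hp)
    rw [List.flatMap_cons]
    refine Path.append ?_ (ih h2)
    rcases lt_or_gt_of_ne hi with h | h
    · exact path_image_of_type1 h h1
    · exact path_image_of_type0 h h1

/-- Every path of `δ` extends to the image of a path of its Rauzy induction. -/
theorem Inducible.exists_extension (hi : δ.Inducible) {u : List A} {x y : ℝ} (hu : u ≠ [])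
    (hp : δ.Path x u y) :
    ∃ (r s u' : List A) (x' y' : ℝ), δ.rauzy.Path x' u' y' ∧
      u'.flatMap (image δ.twist) = r ++ u ++ s ∧ δ.Path x' r x := by
  rcases lt_or_gt_of_ne hi with h | h
  · exact exists_extension_of_type1 h hu hp
  · exact exists_extension_of_type0 h hu hp

end CIET

/-! ### Iterated Rauzy induction -/

namespace CIET

open FreeGroupAut

variable {A : Type*} {N : ℕ}

theorem eq_of_data {δ δ' : CIET A N} (h0 : δ.perm0 = δ'.perm0) (h1 : δ.perm1 = δ'.perm1)
    (hl : δ.len = δ'.len) : δ = δ' := by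
  cases δ
  cases δ'
  simp_all

/-- The CIET with the lengths multiplied by `c`. -/
def scale (δ : CIET A N) (c : ℝ) (hc : 0 < c) : CIET A N where
  two_le := δ.two_le
  perm0 := δ.perm0
  perm1 := δ.perm1
  len a := c * δ.len a
  len_pos a := mul_pos hc (δ.len_pos a)

/-- The letter whose interval is cut by the Rauzy induction. -/
noncomputable def winner (δ : CIET A N) : A :=
  if δ.len δ.last1 < δ.len δ.last0 then δ.last0 else δ.last1

/-- The other letter involved in the Rauzy induction. -/
noncomputable def loser (δ : CIET A N) : A :=
  if δ.len δ.last1 < δ.len δ.last0 then δ.last1 else δ.last0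

variable {δ : CIET A N}

theorem loser_eq_of_ne_winner {a : A} (h : a = δ.last0 ∨ a = δ.last1) (ha : a ≠ δ.winner) :
    δ.loser = a := by
  unfold winner at ha
  unfold loser
  split_ifs at ha ⊢ <;> tauto

variable {c : ℝ} {hc : 0 < c}

theorem inducible_scale : (δ.scale c hc).Inducible ↔ δ.Inducible :=
  (mul_right_injective₀ hc.ne').ne_iff

theorem scale_len_lt_iff {a b : A} :
    (δ.scale c hc).len a < (δ.scale c hc).len b ↔ δ.len a < δ.len b :=
  mul_lt_mul_iff_right₀ hc

theorem scale_last_lt_iff : (δ.scale c hc).len (δ.scale c hc).last1 <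
    (δ.scale c hc).len (δ.scale c hc).last0 ↔ δ.len δ.last1 < δ.len δ.last0 := scale_len_lt_iff

theorem scale_last_lt_iff' : (δ.scale c hc).len (δ.scale c hc).last0 <
    (δ.scale c hc).len (δ.scale c hc).last1 ↔ δ.len δ.last0 < δ.len δ.last1 := scale_len_lt_iff

/-! ### Paths under scaling, and two-letter paths -/

section Paths

variable [Fintype A]

theorem left0_scale (a : A) : (δ.scale c hc).left0 a = c * δ.left0 a := by
  exact (Finset.mul_sum _ _ _).symm

theorem left1_scale (a : A) : (δ.scale c hc).left1 a = c * δ.left1 a := by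
  exact (Finset.mul_sum _ _ _).symm

theorem total_scale : (δ.scale c hc).total = c * δ.total := by
  exact (Finset.mul_sum _ _ _).symm

theorem path_scale {w : List A} {x y : ℝ} :
    (δ.scale c hc).Path (c * x) w (c * y) ↔ δ.Path x w y := by
  induction w generalizing x with
  | nil => simp [path_nil, hc.ne']
  | cons a t ih =>
    rw [path_cons, path_cons, left0_scale, left1_scale, ← ih]
    change (_ ∧ _ ≤ _ + c * δ.len a) ∧ _ ↔ _
    rw [← mul_add, mul_le_mul_iff_right₀ hc, mul_le_mul_iff_right₀ hc, mul_add, mul_sub]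

theorem language_scale : (δ.scale c hc).language = δ.language := by
  ext w
  constructor
  · rintro ⟨x, y, h⟩
    refine ⟨x / c, y / c, (path_scale (c := c) (hc := hc)).1 ?_⟩
    rwa [mul_div_cancel₀ _ hc.ne', mul_div_cancel₀ _ hc.ne']
  · rintro ⟨x, y, h⟩
    exact ⟨_, _, path_scale.2 h⟩

/-- A pair of consecutive letters occurs along a path at a point other than `0`. -/
theorem exists_path_pair {b c : A} (h : [b, c] ∈ δ.language) :
    ∃ x y z, 0 < y ∧ δ.Path x [b] y ∧ δ.Path y [c] z := by
  obtain ⟨x, z, h⟩ := h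
  obtain ⟨y, hb, hc⟩ := path_append.1 (show δ.Path x ([b] ++ [c]) z from h)
  -- If the middle point is `0`, the image of `b` and the interval of `c` both start at `0`, and the
  -- path can be moved right by the smaller of the two lengths.
  rcases (hb.target_mem (by simp)).1.eq_or_lt with rfl | hy
  · have hb' := hb.target_mem_last (w := [])
    have hc' := hc.1
    have h1 := δ.left1_nonneg b
    have h2 := δ.left0_nonneg c
    have hlb := min_le_left (δ.len b) (δ.len c)
    have hlc := min_le_right (δ.len b) (δ.len c)
    have hpos := lt_min (δ.len_pos b) (δ.len_pos c)
    refine ⟨min (δ.len b) (δ.len c) - δ.left1 b + δ.left0 b, _, _, hpos,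
      path_singleton.2 ⟨⟨?_, ?_⟩, by ring⟩, path_singleton.2 ⟨⟨?_, ?_⟩, rfl⟩⟩ <;> linarith
  · exact ⟨x, y, z, hy, hb, hc⟩

end Paths

variable [DecidableEq A]

theorem update_mul_left (len : A → ℝ) (w l a : A) :
    Function.update (fun b => c * len b) w (c * len w - c * len l) a =
      c * Function.update len w (len w - len l) a := by
  by_cases ha : a = w
  · subst ha; simp [mul_sub]
  · simp [ha]

theorem rauzy_scale : (δ.scale c hc).rauzy = δ.rauzy.scale c hc := by
  by_cases h : δ.len δ.last1 < δ.len δ.last0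
  · rw [rauzy_of_type0 h, rauzy_of_type0 (scale_last_lt_iff.2 h)]
    exact eq_of_data rfl rfl (funext fun a => update_mul_left _ _ _ _)
  · by_cases h' : δ.len δ.last0 < δ.len δ.last1
    · rw [rauzy_of_type1 h', rauzy_of_type1 (scale_last_lt_iff'.2 h')]
      exact eq_of_data rfl rfl (funext fun a => update_mul_left _ _ _ _)
    · rw [rauzy, rauzy, dif_neg h, dif_neg h', dif_neg (scale_last_lt_iff.not.2 h),
        dif_neg (scale_last_lt_iff'.not.2 h')]

theorem twist_scale : (δ.scale c hc).twist = δ.twist := by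
  by_cases h : δ.len δ.last1 < δ.len δ.last0
  · rw [twist, twist, dif_pos h, dif_pos (scale_last_lt_iff.2 h)]
    rfl
  · rw [twist, twist, dif_neg h, dif_neg (scale_last_lt_iff.not.2 h)]
    by_cases h' : δ.len δ.last0 < δ.len δ.last1
    · rw [dif_pos h', dif_pos (scale_last_lt_iff'.2 h')]
      rfl
    · rw [dif_neg h', dif_neg (scale_last_lt_iff'.not.2 h')]

theorem iterate_rauzy_scale (m : ℕ) : rauzy^[m] (δ.scale c hc) = (rauzy^[m] δ).scale c hc := by
  induction m with
  | zero => rfl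
  | succ m ih => rw [Function.iterate_succ_apply', ih, rauzy_scale, Function.iterate_succ_apply']

theorem image_twist (hi : δ.Inducible) (a : A) :
    image δ.twist a = if a = δ.loser then [δ.last1, δ.last0] else [a] := by
  rcases lt_or_gt_of_ne hi with h | h
  · rw [image_twist_of_type1 h, loser, if_neg h.not_gt]
  · rw [image_twist_of_type0 h, loser, if_pos h]

theorem mem_image_twist_self (hi : δ.Inducible) (a : A) : a ∈ image δ.twist a := by
  rw [image_twist hi]
  split_ifs with h
  · subst h
    unfold loser
    split_ifs <;> simp
  · simp

theorem winner_mem_image_twist_loser (hi : δ.Inducible) :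
    δ.winner ∈ image δ.twist δ.loser := by
  rw [image_twist hi, if_pos rfl]
  unfold winner
  split_ifs <;> simp

/-- The row in which the winner is last is left unchanged. Hence a winner that does not win the next
step loses it. -/
theorem winner_eq_last_rauzy (hi : δ.Inducible) :
    δ.winner = δ.rauzy.last0 ∨ δ.winner = δ.rauzy.last1 := by
  rcases lt_or_gt_of_ne hi with h | h
  · right
    rw [winner, if_neg h.not_gt, rauzy_of_type1 h]
    rfl
  · left
    rw [winner, if_pos h, rauzy_of_type0 h]
    rfl

theorem len_rauzy_of_ne_winner {a : A} (hi : δ.Inducible) (ha : a ≠ δ.winner) :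
    δ.rauzy.len a = δ.len a := by
  rcases lt_or_gt_of_ne hi with h | h
  · rw [winner, if_neg h.not_gt] at ha
    exact len_rauzy_of_type1 h ha
  · rw [winner, if_pos h] at ha
    exact len_rauzy_of_type0 h ha

theorem len_rauzy_winner_lt (hi : δ.Inducible) : δ.rauzy.len δ.winner < δ.len δ.winner := by
  rcases lt_or_gt_of_ne hi with h | h
  · rw [winner, if_neg h.not_gt, len_rauzy_last1_of_type1 h]
    linarith [δ.len_pos δ.last0]
  · rw [winner, if_pos h, len_rauzy_last0_of_type0 h]
    linarith [δ.len_pos δ.last1]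

theorem len_rauzy_le (hi : δ.Inducible) (a : A) : δ.rauzy.len a ≤ δ.len a := by
  by_cases ha : a = δ.winner
  · rw [ha]
    exact (len_rauzy_winner_lt hi).le
  · exact (len_rauzy_of_ne_winner hi ha).le

/-- The composition of the first `m` Dehn twists. -/
noncomputable def twistProd (δ : CIET A N) (m : ℕ) : MulAut (FreeGroup A) :=
  ((List.range m).map fun i => (rauzy^[i] δ).twist).prod

theorem twistProd_zero (δ : CIET A N) : δ.twistProd 0 = 1 := rfl

theorem twistProd_add (δ : CIET A N) (m k : ℕ) :
    δ.twistProd (m + k) = δ.twistProd m * (rauzy^[m] δ).twistProd k := by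
  rw [twistProd, List.range_add, List.map_append, List.prod_append, List.map_map]
  congr 3
  funext i
  rw [Function.comp_apply, add_comm, Function.iterate_add_apply]

theorem twistProd_succ (δ : CIET A N) (m : ℕ) :
    δ.twistProd (m + 1) = δ.twistProd m * (rauzy^[m] δ).twist := by
  rw [twistProd_add]
  simp [twistProd]

theorem twistProd_scale (m : ℕ) : (δ.scale c hc).twistProd m = δ.twistProd m := by
  simp [twistProd, iterate_rauzy_scale, twist_scale]

theorem isPositive_twistProd (δ : CIET A N) (m : ℕ) : IsPositive (δ.twistProd m) := by
  induction m with
  | zero => exact isPositive_one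
  | succ m ih => rw [twistProd_succ]; exact ih.mul (isPositive_twist _)

theorem image_twistProd_succ (δ : CIET A N) (m : ℕ) (w : List A) :
    w.flatMap (image (δ.twistProd (m + 1))) =
      (w.flatMap (image (rauzy^[m] δ).twist)).flatMap (image (δ.twistProd m)) := by
  rw [twistProd_succ, flatMap_image_mul (isPositive_twistProd δ m) (isPositive_twist _)]

/-- The Rauzy induction can be iterated indefinitely. -/
def InfinitelyInducible (δ : CIET A N) : Prop := ∀ i, (rauzy^[i] δ).Inducible

/-! ### Every letter eventually occurs in all images -/

/-- If every letter wins infinitely often, then every letter eventually occurs in the image of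
every letter. -/
theorem InfinitelyInducible.eventually_mem_image [Finite A] (hi : δ.InfinitelyInducible)
    (hw : ∀ a m, ∃ i, m ≤ i ∧ (rauzy^[i] δ).winner = a) :
    ∀ᶠ m in Filter.atTop, ∀ a b, b ∈ image (δ.twistProd m) a := by
  have := Fintype.ofFinite A
  suffices h : ∀ b, ∀ᶠ m in Filter.atTop, ∀ a, b ∈ image (δ.twistProd m) a by
    filter_upwards [Filter.eventually_all.2 h] with m hm a b using hm b a
  intro b
  have hmem : ∀ m a, b ∈ image (δ.twistProd (m + 1)) a ↔
      ∃ d ∈ image (rauzy^[m] δ).twist a, b ∈ image (δ.twistProd m) d := fun m a => by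
    have := image_twistProd_succ δ m [a]
    simp only [List.flatMap_singleton] at this
    rw [this, List.mem_flatMap]
  -- `C m` is the set of letters whose image at time `m` contains `b`. It increases with `m`, since
  -- a twist keeps each letter in its own image, and so is constant from some `m₀` on.
  let C : ℕ →o Set A := ⟨fun m => {a | b ∈ image (δ.twistProd m) a},
    monotone_nat_of_le_succ fun m a ha => (hmem m a).2 ⟨a, mem_image_twist_self (hi m) a, ha⟩⟩
  have hC : ∀ m a, a ∈ C m ↔ b ∈ image (δ.twistProd m) a := fun _ _ => Iff.rfl
  obtain ⟨m₀, hm₀⟩ := WellFoundedGT.monotone_chain_condition C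
  have hloser : ∀ m, m₀ ≤ m → (rauzy^[m] δ).winner ∈ C m₀ → (rauzy^[m] δ).loser ∈ C m₀ := by
    intro m hm h
    rw [hm₀ m hm] at h
    rw [hm₀ (m + 1) (hm.trans m.le_succ)]
    exact (hmem m _).2 ⟨_, winner_mem_image_twist_loser (hi m), h⟩
  have hb : b ∈ C m₀ := C.monotone (Nat.zero_le m₀) (by
    rw [hC, twistProd_zero, image_one]; simp)
  suffices h : ∀ a, a ∈ C m₀ by
    filter_upwards [Filter.eventually_ge_atTop m₀] with m hm a
    rw [← hC, ← hm₀ m hm]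
    exact h a
  by_contra! ⟨v, hv⟩
  obtain ⟨m₁, h₁, rfl⟩ := hw v m₀
  -- The winners stay outside `C m₀`: a new winner inside would, by `hloser`, bring in the loser,
  -- which is the previous winner. But `b` lies in `C m₀` and wins again.
  have hall : ∀ m, m₁ ≤ m → (rauzy^[m] δ).winner ∉ C m₀ := by
    intro m hm
    induction m, hm using Nat.le_induction with
    | base => exact hv
    | succ m hm ih =>
      intro h
      have hne : (rauzy^[m] δ).winner ≠ (rauzy^[m + 1] δ).winner := fun e => ih (e ▸ h)
      have hl := hloser (m + 1) (by omega) h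
      rw [loser_eq_of_ne_winner (a := (rauzy^[m] δ).winner) ?_ hne] at hl
      · exact ih hl
      · rw [Function.iterate_succ_apply']
        exact winner_eq_last_rauzy (hi m)
  obtain ⟨m₂, h₂, e⟩ := hw b m₁
  exact hall m₂ h₂ (e ▸ hb)

/-! ### Extension of paths along the iterated Rauzy induction -/

section Paths

variable [Fintype A]

theorem InfinitelyInducible.path_image (hi : δ.InfinitelyInducible) (m : ℕ) {x y : ℝ}
    {w : List A} (hp : (rauzy^[m] δ).Path x w y) :
    δ.Path x (w.flatMap (image (δ.twistProd m))) y := by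
  induction m generalizing w with
  | zero => rwa [twistProd_zero, flatMap_image_one]
  | succ m ih =>
    rw [image_twistProd_succ]
    rw [Function.iterate_succ_apply'] at hp
    exact ih ((hi m).path_image hp)

theorem InfinitelyInducible.exists_extension (hi : δ.InfinitelyInducible) (m : ℕ) {u : List A}
    {x y : ℝ} (hu : u ≠ []) (hp : δ.Path x u y) :
    ∃ (r s u' : List A) (x' y' : ℝ), (rauzy^[m] δ).Path x' u' y' ∧
      u'.flatMap (image (δ.twistProd m)) = r ++ u ++ s ∧ δ.Path x' r x := by
  induction m with
  | zero => exact ⟨[], [], u, x, y, hp, by simp [twistProd_zero, flatMap_image_one], rfl⟩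
  | succ m ih =>
    obtain ⟨r, s, u', x', y', hp', e, hr⟩ := ih
    have hu' : u' ≠ [] := by
      rintro rfl
      simp at e
      exact hu e.2.1
    obtain ⟨r', s', v, x'', y'', hv, e', hr'⟩ := (hi m).exists_extension hu' hp'
    refine ⟨r'.flatMap (image (δ.twistProd m)) ++ r, s ++ s'.flatMap (image (δ.twistProd m)), v,
      x'', y'', ?_, ?_, (hi.path_image m hr').append hr⟩
    · rw [Function.iterate_succ_apply']
      exact hv
    · rw [image_twistProd_succ, e', List.flatMap_append, List.flatMap_append, e]
      simp

end Paths

/-! ### Self-induced CIETs -/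

section SelfInduced

variable {n : ℕ}

/-- The CIET is self-induced, with return time `n` and ratio `η`. -/
def IsReturn (δ : CIET A N) (n : ℕ) (η : ℝ) (hη : 0 < η) : Prop :=
  0 < n ∧ (∀ i < n, (rauzy^[i] δ).Inducible) ∧ rauzy^[n] δ = δ.scale η hη

theorem IsReturnTime.exists_isReturn (h : δ.IsReturnTime n) : ∃ η hη, δ.IsReturn n η hη := by
  obtain ⟨hn, hi, h0, h1, η, hη, hl⟩ := h
  exact ⟨η, hη, hn, hi, eq_of_data h0 h1 (funext hl)⟩

variable {η : ℝ} {hη : 0 < η}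

theorem IsReturn.iterate (h : δ.IsReturn n η hη) (q : ℕ) :
    rauzy^[n * q] δ = δ.scale (η ^ q) (pow_pos hη q) := by
  induction q with
  | zero => exact eq_of_data rfl rfl (funext fun a => by simp [scale])
  | succ q ih =>
    rw [mul_add, mul_one, add_comm, Function.iterate_add_apply, ih, iterate_rauzy_scale, h.2.2]
    exact eq_of_data rfl rfl (funext fun a => by simp [scale, pow_succ, mul_assoc])

theorem IsReturn.infinitelyInducible (h : δ.IsReturn n η hη) : δ.InfinitelyInducible := by
  intro i
  rw [← Nat.mod_add_div i n, Function.iterate_add_apply, h.iterate, iterate_rauzy_scale,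
    inducible_scale]
  exact h.2.1 _ (Nat.mod_lt _ h.1)

theorem IsReturn.twistProd_mul (h : δ.IsReturn n η hη) (q : ℕ) :
    δ.twistProd (n * q) = δ.twistProd n ^ q := by
  induction q with
  | zero => rfl
  | succ q ih => rw [mul_add, mul_one, twistProd_add, ih, h.iterate, twistProd_scale, pow_succ]

/-- No length ever increases, and that of the first winner drops at the first step. -/
theorem IsReturn.ratio_lt_one (h : δ.IsReturn n η hη) : η < 1 := by
  have hi := h.infinitelyInducible
  have hle : ∀ m a, (rauzy^[m + 1] δ).len a ≤ (rauzy^[1] δ).len a := fun m a => by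
    induction m with
    | zero => exact le_rfl
    | succ m ih =>
      rw [Function.iterate_succ_apply']
      exact (len_rauzy_le (hi _) a).trans ih
  obtain ⟨m, rfl⟩ := Nat.exists_eq_succ_of_ne_zero h.1.ne'
  have h1 := (hle m δ.winner).trans_lt (len_rauzy_winner_lt (hi 0))
  rw [h.2.2] at h1
  exact (mul_lt_iff_lt_one_left (δ.len_pos δ.winner)).1 h1

/-- A letter that never wins after time `m` keeps its length, but `n` further steps multiply it by
`η < 1`. -/
theorem IsReturn.exists_winner (h : δ.IsReturn n η hη) (a : A) (m : ℕ) :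
    ∃ i, m ≤ i ∧ (rauzy^[i] δ).winner = a := by
  have hi := h.infinitelyInducible
  by_contra! hne
  have hlen : ∀ i, (rauzy^[m + i] δ).len a = (rauzy^[m] δ).len a := fun i => by
    induction i with
    | zero => rfl
    | succ i ih =>
      rw [← add_assoc, Function.iterate_succ_apply',
        len_rauzy_of_ne_winner (hi _) (hne (m + i) (by omega)).symm, ih]
  have h1 := hlen n
  rw [Function.iterate_add_apply, h.2.2, iterate_rauzy_scale] at h1
  exact (mul_lt_of_lt_one_left ((rauzy^[m] δ).len_pos a) h.ratio_lt_one).ne h1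

theorem IsReturn.isPrimitive [Finite A] (h : δ.IsReturn n η hη) :
    IsPrimitive (δ.twistProd n) := by
  obtain ⟨M, hM⟩ := Filter.eventually_atTop.1
    (h.infinitelyInducible.eventually_mem_image h.exists_winner)
  refine ⟨M + 1, M.succ_pos, fun a b => ?_⟩
  rw [← ((isPositive_twistProd δ n).pow _).mem_image_iff, ← h.twistProd_mul]
  exact hM _ (M.le_succ.trans (Nat.le_mul_of_pos_left _ h.1)) a b

variable [Fintype A]

theorem IsReturn.image_mem_language (h : δ.IsReturn n η hη) (q : ℕ) (a : A) :
    image (δ.twistProd n ^ q) a ∈ δ.language := by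
  obtain ⟨x, y, hp⟩ := singleton_mem_language (δ := rauzy^[n * q] δ) a
  have := h.infinitelyInducible.path_image _ hp
  rw [h.twistProd_mul, List.flatMap_singleton] at this
  exact ⟨x, y, this⟩

/-- A block boundary between `b` and `c` would make the middle point `y > 0` the endpoint of a path
of `R^(nq)(δ)`, hence at most `η^q |λ|`; `q` is chosen to make this less than `y`. -/
theorem IsReturn.pair_isInfix (h : δ.IsReturn n η hη) {b c : A} (hbc : [b, c] ∈ δ.language) :
    ∃ q d, [b, c] <:+: image (δ.twistProd n ^ q) d := by
  obtain ⟨x, y, z, hy, hb, hc⟩ := exists_path_pair hbc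
  have htotal : 0 < δ.total := by
    have := (hb.target_mem (by simp)).2
    linarith
  obtain ⟨q, hq⟩ := exists_pow_lt_of_lt_one (div_pos hy htotal) h.ratio_lt_one
  rw [lt_div_iff₀ htotal] at hq
  obtain ⟨r, s, u', x', y', hu', e, hr⟩ :=
    h.infinitelyInducible.exists_extension (n * q) (by simp) (hb.append hc)
  rw [h.twistProd_mul] at e
  rcases List.pair_flatMap_cases (f := image (δ.twistProd n ^ q)) (b := b) (c := c) (w := u')
    (r := r) (s := s) (by simpa using e) with ⟨d, -, hd⟩ | ⟨v, v', rfl, hv⟩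
  · exact ⟨q, d, hd⟩
  · exfalso
    obtain ⟨y'', hvp, -⟩ := path_append.1 hu'
    have hvne : v ≠ [] := by
      rintro rfl
      simp at hv
    have h1 := (hvp.target_mem hvne).2
    have h2 := h.infinitelyInducible.path_image _ hvp
    rw [h.twistProd_mul, hv] at h2
    rw [h2.unique (hr.append hb), h.iterate, total_scale] at h1
    linarith

/-- The language of a self-induced CIET is that of the associated automorphism. -/
theorem IsReturn.mem_language_iff [Nontrivial A] (h : δ.IsReturn n η hη) {k : ℕ} (hk : 0 < k)
    (a : A) (w : List A) :
    w ∈ δ.language ↔ ∃ q, w <:+: image (δ.twistProd n ^ (q * k)) a := by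
  have hpos := isPositive_twistProd δ n
  have hprim := h.isPrimitive
  constructor
  · intro hw
    by_cases hne : w = []
    · exact ⟨0, by simp [hne]⟩
    -- By primitivity every `φ^j(a)` with `j` large contains `d`, so the letter and the exponent can
    -- be adjusted afterwards.
    suffices hd : ∃ q d, w <:+: image (δ.twistProd n ^ q) d by
      obtain ⟨q, d, hd⟩ := hd
      obtain ⟨K, -, hK⟩ := hprim.exists_forall_ge hpos
      refine ⟨q + K, ?_⟩
      obtain ⟨j, hj⟩ := Nat.exists_eq_add_of_le (Nat.le_mul_of_pos_right (q + K) hk)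
      rw [hj, add_assoc, image_pow_add hpos]
      exact hd.trans (List.isInfix_flatMap_of_mem (hK _ (Nat.le_add_right K j) a d))
    obtain ⟨q, hq⟩ := hprim.exists_le_length hpos w.length
    obtain ⟨x, y, hp⟩ := hw
    obtain ⟨r, s, u, x', y', hu, e, -⟩ :=
      h.infinitelyInducible.exists_extension (n * q) hne hp
    rw [h.twistProd_mul] at e
    rcases List.isInfix_flatMap_cases hne (hq q le_rfl) (e ▸ List.infix_append r w s) with
      ⟨d, hd⟩ | ⟨b, c, hbc, hd⟩
    · exact ⟨q, d, hd⟩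
    · have hbc' : [b, c] ∈ (rauzy^[n * q] δ).language :=
        mem_language_of_isInfix hbc ⟨x', y', hu⟩
      -- The induced CIET is a rescaling of `δ`, so the pair `bc` belongs to the language of `δ`
      -- itself.
      rw [h.iterate, language_scale] at hbc'
      obtain ⟨q', d, hd'⟩ := h.pair_isInfix hbc'
      refine ⟨q + q', d, hd.trans ?_⟩
      rw [image_pow_add hpos]
      simpa using hd'.flatMap (image (δ.twistProd n ^ q))
  · rintro ⟨q, hq⟩
    exact mem_language_of_isInfix hq (h.image_mem_language _ a)

end SelfInduced

end CIET

/-! ### The subshift of a CIET and its language -/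

namespace CIET

open DoubleBoundary

variable {A : Type*} {N : ℕ}

theorem nontrivial_alphabet (δ : CIET A N) : Nontrivial A := by
  have : Nontrivial (Fin N) := Fin.nontrivial_iff_two_le.2 δ.two_le
  exact δ.perm0.nontrivial

variable [Fintype A] {δ : CIET A N}

theorem mem_isom_true {a : A} {x y : ℝ} : y ∈ δ.isom (a, true) x ↔ δ.Path x [a] y := by
  rw [isom, PFun.mem_res, path_singleton, Set.mem_Icc, eq_comm]

theorem mem_isom_false {a : A} {x y : ℝ} : y ∈ δ.isom (a, false) x ↔ δ.Path y [a] x := by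
  rw [isom, PFun.mem_res, path_singleton, Set.mem_Icc]
  constructor
  · rintro ⟨⟨h1, h2⟩, rfl⟩
    exact ⟨⟨by linarith, by linarith⟩, by ring⟩
  · rintro ⟨⟨h1, h2⟩, rfl⟩
    exact ⟨⟨by linarith, by linarith⟩, by ring⟩

theorem mem_isomComp_succ {V : FreeBoundary A} {n : ℕ} {x y : ℝ} :
    y ∈ δ.isomComp V (n + 1) x ↔ ∃ z ∈ δ.isomComp V n x, y ∈ δ.isom (V.letter (n + 1)) z := by
  rw [isomComp, PFun.comp_apply]
  exact Part.mem_bind_iff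

theorem mem_isomComp_right (W : ℤ → A) (n : ℕ) {x y : ℝ} :
    y ∈ δ.isomComp (ofBiinfinite W).1.2 n x ↔ δ.Path x (biFactor W 0 (n + 1)) y := by
  induction n generalizing y with
  | zero => exact mem_isom_true
  | succ n ih =>
    rw [mem_isomComp_succ, biFactor_succ, path_append]
    refine exists_congr fun z => and_congr ih ?_
    rw [zero_add]
    exact mem_isom_true

theorem mem_isomComp_left (W : ℤ → A) (n : ℕ) {x y : ℝ} :
    y ∈ δ.isomComp (ofBiinfinite W).1.1 n x ↔ δ.Path y (biFactor W (Int.negSucc n) (n + 1)) x := by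
  induction n generalizing y with
  | zero => exact mem_isom_false
  | succ n ih =>
    have e : Int.negSucc (n + 1) + 1 = Int.negSucc n := by omega
    rw [mem_isomComp_succ, biFactor_succ', e, ← List.singleton_append, path_append]
    exact exists_congr fun z => and_comm.trans (and_congr mem_isom_false ih)

/-- This is where the intervals being closed matters: it feeds the compactness argument for infinite
words. -/
theorem isClosed_source (w : List A) : IsClosed {x | ∃ y, δ.Path x w y} := by
  induction w with
  | nil => simp [path_nil]
  | cons a t ih =>
    have : {x | ∃ y, δ.Path x (a :: t) y} = Set.Icc (δ.left0 a) (δ.left0 a + δ.len a) ∩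
        (fun x => x - δ.left0 a + δ.left1 a) ⁻¹' {x | ∃ y, δ.Path x t y} := by
      ext x
      simp [path_cons]
    rw [this]
    exact isClosed_Icc.inter (ih.preimage (by fun_prop))

theorem isClosed_target (w : List A) : IsClosed {y | ∃ x, δ.Path x w y} := by
  induction w using List.reverseRecOn with
  | nil => simp [path_nil]
  | append_singleton t a ih =>
    have : {y | ∃ x, δ.Path x (t ++ [a]) y} = Set.Icc (δ.left1 a) (δ.left1 a + δ.len a) ∩
        (fun y => y - δ.left1 a + δ.left0 a) ⁻¹' {y | ∃ x, δ.Path x t y} := by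
      ext y
      simp only [path_append, path_singleton, Set.mem_ofPred_eq, Set.mem_inter_iff, Set.mem_Icc,
        Set.mem_preimage]
      constructor
      · rintro ⟨x, z, h, ⟨h1, h2⟩, rfl⟩
        exact ⟨⟨by linarith, by linarith⟩, x, by convert h using 1; ring⟩
      · rintro ⟨⟨h1, h2⟩, x, h⟩
        exact ⟨x, _, h, ⟨by linarith, by linarith⟩, by ring⟩
    rw [this]
    exact isClosed_Icc.inter (ih.preimage (by fun_prop))

/-- Each central factor provides a point at place `0`. The sets of such points are nested, compact
and non-empty, so one point serves for all factors. -/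
theorem ofBiinfinite_mem_subshift_iff {W : ℤ → A} :
    ofBiinfinite W ∈ δ.subshift ↔ ∀ n : ℕ, biFactor W (-n) (2 * n) ∈ δ.language := by
  have hcast : ∀ n : ℕ, (-(n + 1 : ℕ) : ℤ) = Int.negSucc n := fun n => rfl
  simp only [subshift, Set.mem_iUnion, subshiftAt, Set.mem_ofPred_eq, PFun.mem_dom,
    mem_isomComp_left, mem_isomComp_right]
  constructor
  · rintro ⟨x, -, hx⟩ n
    cases n with
    | zero => exact ⟨0, 0, rfl⟩
    | succ n =>
      obtain ⟨⟨-, z, hz⟩, ⟨-, y, hy⟩⟩ := hx n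
      rw [biFactor_neg_two_mul, hcast]
      exact ⟨z, y, hz.append hy⟩
  · intro h
    have hpath : ∀ n : ℕ, ∃ x, (∃ z, δ.Path z (biFactor W (Int.negSucc n) (n + 1)) x) ∧
        ∃ y, δ.Path x (biFactor W 0 (n + 1)) y := fun n => by
      obtain ⟨z, y, h⟩ := h (n + 1)
      rw [biFactor_neg_two_mul, hcast] at h
      obtain ⟨x, hz, hy⟩ := path_append.1 h
      exact ⟨x, ⟨z, hz⟩, y, hy⟩
    let K : ℕ → Set ℝ := fun n => {x | ∃ z, δ.Path z (biFactor W (Int.negSucc n) (n + 1)) x} ∩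
      {x | ∃ y, δ.Path x (biFactor W 0 (n + 1)) y}
    have hclosed : ∀ n, IsClosed (K n) := fun n => (isClosed_target _).inter (isClosed_source _)
    have hsub : ∀ n, K n ⊆ Set.Icc 0 δ.total := by
      rintro n x ⟨-, y, hy⟩
      exact hy.source_mem (by simp [biFactor_succ])
    obtain ⟨x, hx⟩ := IsCompact.nonempty_iInter_of_sequence_nonempty_isCompact_isClosed K
      (by
        rintro n x ⟨⟨z, hz⟩, y, hy⟩
        have e : Int.negSucc (n + 1) + 1 = Int.negSucc n := by omega
        rw [biFactor_succ', e, ← List.singleton_append, path_append] at hz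
        rw [biFactor_succ, path_append] at hy
        obtain ⟨z', -, hz⟩ := hz
        obtain ⟨y', hy, -⟩ := hy
        exact ⟨⟨z', hz⟩, y', hy⟩)
      hpath (isCompact_Icc.of_isClosed_subset (hclosed 0) (hsub 0)) hclosed
    rw [Set.mem_iInter] at hx
    exact ⟨x, hsub 0 (hx 0), fun n => ⟨⟨rfl, (hx n).1⟩, rfl, (hx n).2⟩⟩

theorem subshift_eq_image : δ.subshift =
    ofBiinfinite '' {V | ∀ n : ℕ, biFactor V (-n) (2 * n) ∈ δ.language} := by
  ext P
  constructor
  · intro hP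
    obtain ⟨V, rfl⟩ : ∃ V, P = ofBiinfinite V := by
      obtain ⟨x, -, h⟩ := Set.mem_iUnion₂.1 hP
      exact eq_ofBiinfinite (fun n => (h n).1.1) fun n => (h n).2.1
    exact ⟨V, ofBiinfinite_mem_subshift_iff.1 hP, rfl⟩
  · rintro ⟨V, hV, rfl⟩
    exact ofBiinfinite_mem_subshift_iff.2 hV

end CIET

theorem mainTheorem2 {A : Type*} [Fintype A] [DecidableEq A] {N : ℕ} (δ : CIET A N)
    (hδ : δ.IsSelfInduced) :
    FreeGroupAut.IsPositive δ.automorphism ∧ FreeGroupAut.IsPrimitive δ.automorphism ∧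
      (∀ a : A, ∃ (k : ℕ) (p s : FreeGroup A), FreeGroupAut.IsSeed δ.automorphism a k p s) ∧
      ∀ (a : A) (k : ℕ) (p s : FreeGroup A), FreeGroupAut.IsSeed δ.automorphism a k p s →
        ∃ Z : DoubleBoundary A, FreeGroupAut.IsLimitPoint δ.automorphism a k p s Z ∧
          δ.subshift = closure (DoubleBoundary.orbit Z) := by
  have := δ.nontrivial_alphabet
  obtain ⟨η, hη, h⟩ := (show δ.IsReturnTime δ.period from Nat.sInf_mem hδ).exists_isReturn
  -- `automorphism` unfolds to `twistProd` at the period.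
  have hpos : FreeGroupAut.IsPositive δ.automorphism := δ.isPositive_twistProd δ.period
  have hprim : FreeGroupAut.IsPrimitive δ.automorphism := h.isPrimitive
  refine ⟨hpos, hprim, hprim.exists_isSeed hpos, fun a k p s hs => ?_⟩
  obtain ⟨W, hW, hfactor⟩ := hs.exists_limit hpos
  refine ⟨_, hW, ?_⟩
  rw [CIET.subshift_eq_image, DoubleBoundary.closure_orbit_ofBiinfinite]
  -- Both sides are sets of bi-infinite words given by conditions on central factors; the equality
  -- of languages identifies them.
  congr 1
  ext V
  refine forall_congr' fun n => ?_
  have h1 := hfactor (biFactor V (-n) (2 * n))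
  rw [length_biFactor] at h1
  exact (h.mem_language_iff hs.pos a _).trans h1.symm
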